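/- Let $G$ be a (finite-dimensional, real) Lie group and let $H\subset G$ be an arbitrary subgroup, not assumed closed, endowed with its canonical Lie group structure, i.e. the unique one for which a map from any $\mathbf R^n$ to $H$ is smooth if and only if it is smooth as a map to $G$. Write $\mathfrak g,\mathfrak h$ for the Lie algebras, and let $H$ act on the cotangent bundle $T^*G$ by $h(p)=ph^{-1}$, where $\langle ph^{-1},v\rangle=\langle p,vh\rangle$; let $\varpi_{T^*G}$ be the canonical $1$-form of $T^*G$. For $p\in T^*_qG$ let $q^{-1}p\in\mathfrak g^*$ be $\langle q^{-1}p,Z\rangle=\langle p,qZ\rangle$. For an action of $H$ on a manifold $Y$ and $Z\in\mathfrak h$, write $Z_Y(y)=\frac{d}{dt}e^{tZ}(y)\big|_{t=0}$. Let $Y$ be either (a) a Hamiltonian $H$-space $(Y,\omega_Y,\Psi)$: a manifold with a smooth $H$-action, an $H$-invariant symplectic form $\omega_Y$ and an $\mathrm{Ad}^*$-equivariant moment map $\Psi:Y\to\mathfrak h^*$, with $\omega_Y(Z_Y,\cdot)=-d\langle\Psi,Z\rangle$ for all $Z\in\mathfrak h$; or (b) a prequantum $H$-space $(Y,\varpi_Y)$: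 a manifold with a smooth $H$-action and an $H$-invariant contact $1$-form $\varpi_Y$ whose Reeb vector field generates a free action of the circle group; in this case let $\Psi:Y\to\mathfrak h^*$ be the prequantum moment map $\langle\Psi(y),Z\rangle=\varpi_Y(Z_Y(y))$. In both cases let $L=T^*G\times Y$ with the $H$-action $h(p,y)=(ph^{-1},h(y))$, let $$\psi:L\to\mathfrak h^*,\qquad \psi(p,y)=\Psi(y)-(q^{-1}p)|_{\mathfrak h}\qquad(p\in T^*_qG),$$ and define the induced space as $\mathrm{Ind}_H^GY=\psi^{-1}(0)/H$, with its subquotient diffeology (the quotient diffeology of the subset diffeology of $\psi^{-1}(0)\subset L$). Let $j:\psi^{-1}(0)\to L$ be the inclusion and $\pi:\psi^{-1}(0)\to\mathrm{Ind}_H^GY$ the projection. Then in case (a) $\mathrm{Ind}_H^GY$ carries a reduced $2$-form: there is a diffeological $2$-form $\alpha$ on $\mathrm{Ind}_H^GY$ such that $\pi^*\alpha=j^*(d\varpi_{T^*G}+\omega_Y)$. In case (b) $\mathrm{Ind}_H^GY$ carries a reduced $1$-form: there is a diffeological $1$-form $\alpha$ on $\mathrm{Ind}_H^GY$ such that $\pi^*\alpha=j^*(\varpi_{T^*G}+\varpi_Y)$.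 -/

import Mathlib

open Set Bundle
open scoped Manifold ContDiff Topology

noncomputable section

namespace Induction

/-! ### Diffeologies

Plots are Mathlib's: maps defined on the whole of `ℝⁿ`, for all `n`. -/

/-- Every point `x` of an open set `u` of `ℝⁿ` has a smooth map `ℝⁿ → u` which is the identity
near `x`. -/
theorem exists_contDiff_retract {n : ℕ} {u : Set (EuclideanSpace ℝ (Fin n))} (hu : IsOpen u)
    {x : EuclideanSpace ℝ (Fin n)} (hx : x ∈ u) :
    ∃ f : EuclideanSpace ℝ (Fin n) → EuclideanSpace ℝ (Fin n),
      ContDiff ℝ ∞ f ∧ (∀ z, f z ∈ u) ∧ ∀ᶠ z in 𝓝 x, f z = z := by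
  obtain ⟨r, hr, hru⟩ := Metric.isOpen_iff.1 hu x hx
  let b : ContDiffBump x := ⟨r / 2, r, half_pos hr, half_lt_self hr⟩
  refine ⟨fun z => x + b z • (z - x),
    contDiff_const.add (b.contDiff.smul (contDiff_id.sub contDiff_const)), fun z => hru ?_, ?_⟩
  · rw [Metric.mem_ball, dist_eq_norm, add_sub_cancel_left, norm_smul, Real.norm_eq_abs,
      abs_of_nonneg b.nonneg]
    by_cases hz : z ∈ Metric.ball x r
    · calc b z * ‖z - x‖ ≤ 1 * ‖z - x‖ := by gcongr; exact b.le_one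
        _ < r := by rw [one_mul, ← dist_eq_norm]; exact hz
    · rw [b.zero_of_le_dist (by simpa using hz), zero_mul]
      exact hr
  · filter_upwards [b.eventuallyEq_one] with z hz
    rw [hz]
    simp

/-- The standard diffeology of a manifold: the plots are the smooth maps `ℝⁿ → M`. -/
@[reducible]
def manifoldDiffeology {E : Type*} [NormedAddCommGroup E] [NormedSpace ℝ E] {A : Type*}
    [TopologicalSpace A] (I : ModelWithCorners ℝ E A) (M : Type*) [TopologicalSpace M]
    [ChartedSpace A M] : DiffeologicalSpace M where
  plots n := {p | ContMDiff 𝓘(ℝ, EuclideanSpace ℝ (Fin n)) I ∞ p}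
  constant_plots _ := contMDiff_const
  plot_reparam hp hf := ContMDiff.comp hp hf.contMDiff
  locality := by
    intro n p hp x
    obtain ⟨u, hu, hxu, h⟩ := hp x
    obtain ⟨f, hf, hfu, hfx⟩ := exists_contDiff_retract hu hxu
    exact (h hfu hf x).congr_of_eventuallyEq (hfx.mono fun z hz => by simp [hz])

/-- The subset diffeology: the plots are the plots of `X` that take values in `s`. -/
@[reducible]
def subsetDiffeology {X : Type*} (d : DiffeologicalSpace X) (s : Set X) :
    DiffeologicalSpace s where
  plots n := {p | (fun u => (p u : X)) ∈ d.plots n}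
  constant_plots x := d.constant_plots (x : X)
  plot_reparam hp hf := d.plot_reparam hp hf
  locality := by
    intro n p hp
    refine d.locality fun x => ?_
    obtain ⟨u, hu, hxu, h⟩ := hp x
    exact ⟨u, hu, hxu, fun hfu hf => h hfu hf⟩

/-- The quotient diffeology: the plots are the maps that locally lift to plots of `X`. -/
@[reducible]
def quotientDiffeology {X : Type*} (d : DiffeologicalSpace X) (r : X → X → Prop) :
    DiffeologicalSpace (Quot r) where
  plots n := {p | ∀ x, ∃ q ∈ d.plots n, ∀ᶠ z in 𝓝 x, p z = Quot.mk r (q z)}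
  constant_plots y := by
    obtain ⟨y, rfl⟩ := Quot.exists_rep y
    exact fun x => ⟨fun _ => y, d.constant_plots y, Filter.Eventually.of_forall fun _ => rfl⟩
  plot_reparam := by
    intro n m p f hp hf x
    obtain ⟨q, hq, h⟩ := hp (f x)
    exact ⟨q ∘ f, d.plot_reparam hq hf, hf.continuous.continuousAt.eventually h⟩
  locality := by
    intro n p hp x
    obtain ⟨u, hu, hxu, h⟩ := hp x
    obtain ⟨f, hf, hfu, hfx⟩ := exists_contDiff_retract hu hxu
    obtain ⟨q, hq, hqx⟩ := h hfu hf x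
    refine ⟨q, hq, ?_⟩
    filter_upwards [hqx, hfx] with z hz hz'
    rw [← hz, Function.comp_apply, hz']

/-- The projection onto a quotient is smooth. -/
theorem quot_mk_comp_mem_plots {X : Type*} (d : DiffeologicalSpace X) (r : X → X → Prop) {n : ℕ}
    {p : EuclideanSpace ℝ (Fin n) → X} (hp : p ∈ d.plots n) :
    (fun u => Quot.mk r (p u)) ∈ (quotientDiffeology d r).plots n :=
  fun _ => ⟨p, hp, Filter.Eventually.of_forall fun _ => rfl⟩

/-- A differential `k`-form on a diffeological space: it assigns to every plot `p` on `ℝⁿ` a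
smooth `k`-form on `ℝⁿ` (thought of as the pull-back by `p`), compatibly with smooth
reparametrizations. -/
structure DiffForm {X : Type*} (d : DiffeologicalSpace X) (k : ℕ) where
  onPlot : ∀ {n : ℕ} (p : EuclideanSpace ℝ (Fin n) → X), p ∈ d.plots n →
    EuclideanSpace ℝ (Fin n) → EuclideanSpace ℝ (Fin n) [⋀^Fin k]→L[ℝ] ℝ
  smooth : ∀ {n : ℕ} (p : EuclideanSpace ℝ (Fin n) → X) (hp : p ∈ d.plots n),
    ContDiff ℝ ∞ (onPlot p hp)
  reparam : ∀ {n m : ℕ} (p : EuclideanSpace ℝ (Fin m) → X) (hp : p ∈ d.plots m)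
    (f : EuclideanSpace ℝ (Fin n) → EuclideanSpace ℝ (Fin m)) (hf : ContDiff ℝ ∞ f)
    (u : EuclideanSpace ℝ (Fin n)),
    onPlot (p ∘ f) (d.plot_reparam hp hf) u =
      (onPlot p hp (f u)).compContinuousLinearMap (fderiv ℝ f u)

/-! ### Differential forms on manifolds (without boundary) -/

section Forms

variable {E : Type*} [NormedAddCommGroup E] [NormedSpace ℝ E] {A : Type*} [TopologicalSpace A]
  (I : ModelWithCorners ℝ E A) {M : Type*} [TopologicalSpace M] [ChartedSpace A M]
  {E' : Type*} [NormedAddCommGroup E'] [NormedSpace ℝ E'] {A' : Type*} [TopologicalSpace A']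
  (I' : ModelWithCorners ℝ E' A') {M' : Type*} [TopologicalSpace M'] [ChartedSpace A' M']

/-- A (not necessarily smooth) differential `k`-form on the manifold `M`. -/
abbrev MForm (M : Type*) [TopologicalSpace M] [ChartedSpace A M] (k : ℕ) : Type _ :=
  ∀ x : M, TangentSpace I x [⋀^Fin k]→L[ℝ] ℝ

/-- The pull-back of a form by a map of manifolds. -/
def MForm.pullback {k : ℕ} (f : M → M') (σ : MForm I' M' k) : MForm I M k :=
  fun x => (σ (f x)).compContinuousLinearMap (mfderiv I I' f x)

/-- The expression of a form in the preferred chart at `x₀`. -/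
def MForm.inChart {k : ℕ} (σ : MForm I M k) (x₀ : M) : E → E [⋀^Fin k]→L[ℝ] ℝ :=
  MForm.pullback 𝓘(ℝ, E) I (extChartAt I x₀).symm σ

/-- Smoothness of a form: its expression in every preferred chart is smooth. -/
def MForm.IsSmooth {k : ℕ} (σ : MForm I M k) : Prop :=
  ∀ x₀ : M, ContDiffOn ℝ ∞ (MForm.inChart I σ x₀) (extChartAt I x₀).target

/-- The exterior derivative, computed in the preferred chart at each point. -/
def MForm.d {k : ℕ} (σ : MForm I M k) : MForm I M (k + 1) :=
  fun x => (extDeriv (MForm.inChart I σ x) (extChartAt I x x)).compContinuousLinearMap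
    (mfderiv I 𝓘(ℝ, E) (extChartAt I x) x)

end Forms

/-! ### Reduced spaces and reduced forms -/

section Reduced

variable {E : Type*} [NormedAddCommGroup E] [NormedSpace ℝ E] {A : Type*} [TopologicalSpace A]
  (I : ModelWithCorners ℝ E A) {M : Type*} [TopologicalSpace M] [ChartedSpace A M]
  {K : Type*} (act : K → M → M) (C : Set M)

/-- The orbit space `C / K` of a `K`-stable subset `C` of `M`, for a group action
`act : K → M → M`. -/
def ReducedSpace : Type _ := Quot fun x y : C => ∃ k : K, (y : M) = act k x

/-- The subquotient diffeology of `C / K`. -/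
@[reducible]
def reducedDiffeology : DiffeologicalSpace (ReducedSpace act C) :=
  quotientDiffeology (subsetDiffeology (manifoldDiffeology I M) C) _

/-- `C / K` carries a reduced form for the form `σ` on `M`: there is a diffeological form `α`
on `C / K` with `π^* α = j^* σ`, where `j : C → M` is the inclusion and `π : C → C / K` the
projection. Both sides are forms on the diffeological space `C`, so the equality means that they
agree on every plot `p` of `C`. -/
def CarriesReducedForm {k : ℕ} (σ : MForm I M k) : Prop :=
  ∃ α : DiffForm (reducedDiffeology I act C) k,
    ∀ (n : ℕ) (p : EuclideanSpace ℝ (Fin n) → C)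
      (hp : p ∈ (subsetDiffeology (manifoldDiffeology I M) C).plots n)
      (u : EuclideanSpace ℝ (Fin n)),
      α.onPlot (fun v => Quot.mk _ (p v)) (quot_mk_comp_mem_plots _ _ hp) u =
        MForm.pullback 𝓘(ℝ, EuclideanSpace ℝ (Fin n)) I (fun v => (p v : M)) σ u

end Reduced

/-! ### Lie group actions, Hamiltonian spaces, prequantum spaces

The Lie algebra of a Lie group `K` modelled on `F` is the tangent space at `1`, which is `F` as a
vector space; so its dual is `F →L[ℝ] ℝ`. -/

section Spaces

variable {F : Type*} [NormedAddCommGroup F] [NormedSpace ℝ F]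
  {K : Type*} [Group K] [TopologicalSpace K] [ChartedSpace F K]
  {E : Type*} [NormedAddCommGroup E] [NormedSpace ℝ E]
  {Y : Type*} [TopologicalSpace Y] [ChartedSpace E Y]

variable (E) in
/-- The infinitesimal action `Z ↦ Z_Y(y) = d/dt exp(tZ)(y)` at `t = 0`, i.e. the derivative at the
identity of `k ↦ k(y)`. -/
def infinitesimalAction [MulAction K Y] (y : Y) : F →L[ℝ] E :=
  mfderiv 𝓘(ℝ, F) 𝓘(ℝ, E) (fun k : K => k • y) 1

variable (F) in
/-- The adjoint action of `k` on the Lie algebra. -/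
def Ad (k : K) : F →L[ℝ] F :=
  mfderiv 𝓘(ℝ, F) 𝓘(ℝ, F) (fun x : K => k * x * k⁻¹) 1

variable (K) in
/-- Invariance of a form under the action of `K`. -/
def IsInvariantForm [MulAction K Y] {k : ℕ} (σ : MForm 𝓘(ℝ, E) Y k) : Prop :=
  ∀ g : K, MForm.pullback 𝓘(ℝ, E) 𝓘(ℝ, E) (fun y : Y => g • y) σ = σ

/-- A symplectic form: smooth, closed, non-degenerate. -/
structure IsSymplectic (σ : MForm 𝓘(ℝ, E) Y 2) : Prop where
  smooth : MForm.IsSmooth 𝓘(ℝ, E) σ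
  closed : MForm.d 𝓘(ℝ, E) σ = 0
  nondegenerate : ∀ (y : Y) (v : TangentSpace 𝓘(ℝ, E) y), (∀ w, σ y ![v, w] = 0) → v = 0

variable (K) in
/-- `(Y, σ, Ψ)` is a Hamiltonian `K`-space (for a smooth action of `K` on the manifold `Y`): `σ` is
an invariant symplectic form and `Ψ` an `Ad^*`-equivariant moment map, with the sign convention
`σ(Z_Y, ·) = - d⟨Ψ, Z⟩`. -/
structure IsHamiltonianSpace [MulAction K Y] (σ : MForm 𝓘(ℝ, E) Y 2) (Ψ : Y → (F →L[ℝ] ℝ)) :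
    Prop where
  symplectic : IsSymplectic σ
  invariant : IsInvariantForm K σ
  smooth_moment : ContMDiff 𝓘(ℝ, E) 𝓘(ℝ, F →L[ℝ] ℝ) ∞ Ψ
  moment : ∀ (y : Y) (Z : F) (v : TangentSpace 𝓘(ℝ, E) y),
    σ y ![infinitesimalAction (K := K) E y Z, v] =
      - (mfderiv 𝓘(ℝ, E) 𝓘(ℝ, ℝ) (fun y' : Y => Ψ y' Z) y v : ℝ)
  equivariant : ∀ (k : K) (y : Y) (Z : F), Ψ (k • y) Z = Ψ y (Ad F k⁻¹ Z)

/-- A contact form: a smooth `1`-form `ϖ` that vanishes nowhere and whose derivative is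
non-degenerate on `ker ϖ`. -/
structure IsContact (ϖ : MForm 𝓘(ℝ, E) Y 1) : Prop where
  smooth : MForm.IsSmooth 𝓘(ℝ, E) ϖ
  ne_zero : ∀ y, ϖ y ≠ 0
  nondegenerate : ∀ (y : Y) (v : TangentSpace 𝓘(ℝ, E) y), ϖ y ![v] = 0 →
    (∀ w, ϖ y ![w] = 0 → MForm.d 𝓘(ℝ, E) ϖ y ![v, w] = 0) → v = 0

/-- The vector `R` is the value at `y` of the Reeb vector field of `ϖ`. -/
def IsReebAt (ϖ : MForm 𝓘(ℝ, E) Y 1) (y : Y) (R : TangentSpace 𝓘(ℝ, E) y) : Prop :=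
  ϖ y ![R] = 1 ∧ ∀ w, MForm.d 𝓘(ℝ, E) ϖ y ![R, w] = 0

variable (K) in
/-- `(Y, ϖ)` is a prequantum `K`-space (for a smooth action of `K` on the manifold `Y`): `ϖ` is an
invariant contact form whose Reeb vector field generates a free smooth action of the circle
group, `t` acting by `exp(it)`. -/
structure IsPrequantumSpace [MulAction K Y] (ϖ : MForm 𝓘(ℝ, E) Y 1) : Prop where
  contact : IsContact ϖ
  invariant : IsInvariantForm K ϖ
  reeb : ∃ _ : MulAction Circle Y,
    ContMDiff ((𝓡 1).prod 𝓘(ℝ, E)) 𝓘(ℝ, E) ∞ (fun x : Circle × Y => x.1 • x.2) ∧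
    (∀ (z : Circle) (y : Y), z • y = y → z = 1) ∧
    ∀ y : Y, IsReebAt ϖ (Circle.exp 0 • y)
      (mfderiv 𝓘(ℝ, ℝ) 𝓘(ℝ, E) (fun t : ℝ => Circle.exp t • y) 0 (1 : ℝ))

/-- The prequantum moment map `⟨Ψ(y), Z⟩ = ϖ(Z_Y(y))`. -/
def prequantumMoment [MulAction K Y] (ϖ : MForm 𝓘(ℝ, E) Y 1) (y : Y) : F →L[ℝ] ℝ :=
  ((ContinuousAlternatingMap.ofSubsingleton ℝ E ℝ (0 : Fin 1)).symm (ϖ y)).comp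
    (infinitesimalAction (K := K) E y)

end Spaces

/-! ### Subgroups, cotangent bundle, induction -/

section Group

variable {E : Type*} [NormedAddCommGroup E] [NormedSpace ℝ E]
  {G : Type*} [Group G] [TopologicalSpace G] [ChartedSpace E G]

/-- The Lie group `K`, with the group isomorphism `e : K ≃* H`, is the subgroup `H` of the Lie group
`G` with its canonical Lie group structure. This is the unique manifold structure on the group
`H` (which need not be closed, and whose topology need not be the subspace topology) for which a map
into `H` is smooth if and only if it is smooth as a map into `G`. -/
def IsCanonicalLieStructure {F : Type*} [NormedAddCommGroup F] [NormedSpace ℝ F]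
    {K : Type*} [Group K] [TopologicalSpace K] [ChartedSpace F K] (H : Subgroup G)
    (e : K ≃* H) : Prop :=
  ∀ (n : ℕ) (p : EuclideanSpace ℝ (Fin n) → K),
    ContMDiff 𝓘(ℝ, EuclideanSpace ℝ (Fin n)) 𝓘(ℝ, F) ∞ p ↔
      ContMDiff 𝓘(ℝ, EuclideanSpace ℝ (Fin n)) 𝓘(ℝ, E) ∞ (fun u => (e (p u) : G))

variable [LieGroup 𝓘(ℝ, E) ∞ G]

variable (E G) in
/-- The cotangent bundle `T^*G`, with Mathlib's structure of vector bundle and manifold. -/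
abbrev Cotangent : Type _ :=
  TotalSpace (E →L[ℝ] ℝ)
    (fun g : G => TangentSpace 𝓘(ℝ, E) g →L[ℝ] Bundle.Trivial G ℝ g)

variable (E) in
/-- The model with corners of `T^*G`. -/
abbrev cotangentModel : ModelWithCorners ℝ (E × (E →L[ℝ] ℝ)) (ModelProd E (E →L[ℝ] ℝ)) :=
  𝓘(ℝ, E).prod 𝓘(ℝ, E →L[ℝ] ℝ)

/-- The value of the covector `p ∈ T^*_q G` on tangent vectors at `q`. -/
def Cotangent.covector (p : Cotangent E G) : E →L[ℝ] ℝ := p.2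

/-- The canonical `1`-form of `T^*G`: `ϖ(δp) = ⟨p, δq⟩`, with `δq` the image of `δp` by the derivative
of the projection. -/
def canonicalForm : MForm (cotangentModel E) (Cotangent E G) 1 := fun p =>
  ContinuousAlternatingMap.ofSubsingleton ℝ (E × (E →L[ℝ] ℝ)) ℝ (0 : Fin 1)
    (p.covector.comp
      (mfderiv (cotangentModel E) 𝓘(ℝ, E) (fun p' : Cotangent E G => p'.proj) p))

/-- The translate `p h ∈ T^*_{qh} G` of `p ∈ T^*_q G`: `⟨p h, v⟩ = ⟨p, v h⁻¹⟩` for `v ∈ T_{qh} G`. -/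
def rightTranslate (p : Cotangent E G) (h : G) : Cotangent E G :=
  ⟨p.proj * h, p.covector.comp
    (mfderiv 𝓘(ℝ, E) 𝓘(ℝ, E) (fun x : G => x * h⁻¹) (p.proj * h) : E →L[ℝ] E)⟩

variable {F : Type*} [NormedAddCommGroup F] [NormedSpace ℝ F]
  {K : Type*} [Group K] [TopologicalSpace K] [ChartedSpace F K]
  {H : Subgroup G} (e : K ≃* H)
  {E' : Type*} [NormedAddCommGroup E'] [NormedSpace ℝ E']
  {Y : Type*} [TopologicalSpace Y] [ChartedSpace E' Y]

variable (E) in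
/-- The action `h(p, y) = (p h⁻¹, h(y))` of `H` on `T^*G × Y`. -/
def inducingAction [MulAction K Y] (k : K) (x : Cotangent E G × Y) : Cotangent E G × Y :=
  (rightTranslate x.1 ((e k : G)⁻¹), k • x.2)

variable (E F) in
/-- The inclusion of Lie algebras, derivative at the identity of the inclusion of `H` in `G`. -/
def lieAlgebraInclusion : F →L[ℝ] E :=
  mfderiv 𝓘(ℝ, F) 𝓘(ℝ, E) (fun k : K => (e k : G)) 1

variable (F) in
/-- The restriction to the Lie algebra of `H` of the element `q⁻¹ p` of the dual Lie algebra of `G`,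
for `p ∈ T^*_q G`: here `⟨q⁻¹ p, Z⟩ = ⟨p, q Z⟩`. -/
def leftMoment (p : Cotangent E G) : F →L[ℝ] ℝ :=
  (p.covector.comp
    (mfderiv 𝓘(ℝ, E) 𝓘(ℝ, E) (fun x : G => p.proj * x) 1 : E →L[ℝ] E)).comp
    (lieAlgebraInclusion E F e)

/-- The moment map `ψ(p, y) = Ψ(y) - (q⁻¹ p)|_𝔥` of the action of `H` on `T^*G × Y`,
where `p ∈ T^*_q G`. -/
def inducingMoment (Ψ : Y → (F →L[ℝ] ℝ)) (x : Cotangent E G × Y) : F →L[ℝ] ℝ :=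
  Ψ x.2 - leftMoment F e x.1

/-- The zero level `ψ⁻¹(0)`. -/
def zeroLevel (Ψ : Y → (F →L[ℝ] ℝ)) : Set (Cotangent E G × Y) :=
  {x | inducingMoment e Ψ x = 0}

variable (E E') in
/-- The model with corners of `T^*G × Y`. -/
abbrev inducingModel : ModelWithCorners ℝ ((E × (E →L[ℝ] ℝ)) × E')
    (ModelProd (ModelProd E (E →L[ℝ] ℝ)) E') :=
  (cotangentModel E).prod 𝓘(ℝ, E')

/-- The sum on `T^*G × Y` of the pull-backs of a form on `T^*G` and a form on `Y`. -/
def sumForm {k : ℕ} (α : MForm (cotangentModel E) (Cotangent E G) k) (β : MForm 𝓘(ℝ, E') Y k) :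
    MForm (inducingModel E E') (Cotangent E G × Y) k :=
  MForm.pullback (inducingModel E E') (cotangentModel E) Prod.fst α +
    MForm.pullback (inducingModel E E') 𝓘(ℝ, E') Prod.snd β

/-- The `2`-form `dϖ_{T^*G} + σ` on `T^*G × Y`. -/
def inducingTwoForm (σ : MForm 𝓘(ℝ, E') Y 2) :
    MForm (inducingModel E E') (Cotangent E G × Y) 2 :=
  sumForm (MForm.d (cotangentModel E) canonicalForm) σ

/-- The `1`-form `ϖ_{T^*G} + ϖ` on `T^*G × Y`. -/
def inducingOneForm (ϖ : MForm 𝓘(ℝ, E') Y 1) :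
    MForm (inducingModel E E') (Cotangent E G × Y) 1 :=
  sumForm canonicalForm ϖ

end Group

end Induction

end

/-!
# Reduced forms on induced spaces

Write `C = ψ⁻¹(0)`. A plot of `C / H` lifts locally to a plot `q` of `C`, and the value of the
reduced form on it is the pull-back by `q` of the given form on `T^*G × Y`. So everything amounts to
showing that two plots `q`, `q'` of `C` with the same projection have the same pull-back
(`carriesReducedForm_of_onSpace_eq`).

*The two lifts differ by a plot of the group.* Pointwise `q' = k(q)` with `k` in `H`. The base
points `g`, `g'` in `G` satisfy `g' = g k⁻¹`, so `k = g'⁻¹ g` is a smooth map into `G` with values in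
`H`, hence is smooth for the canonical structure of `H`
(`IsCanonicalLieStructure.exists_plot`). No closedness of `H` and no slice theorem is needed.

*The change of the pull-backs.* After translation by `k(u)⁻¹`, which preserves the invariant forms,
`k(u) = 1` and the velocity of `q'` is the velocity of `q` plus the value `Z_M` of the
infinitesimal action on the logarithmic derivative `Z` of `k` (`IsSmoothAction.onSpace_act`). So the
pull-back of an invariant `1`-form changes by its moment (`IsSmoothAction.onSpace_oneForm`), and that
of an invariant `2`-form with equivariant moment map `μ` by derivatives of the functions `μ ∘ q` and
`μ ∘ q'` (`IsSmoothAction.onSpace_twoForm`). The second statement applies to `dϖ` for an invariant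
`1`-form `ϖ`, whose moment map is `Z ↦ ϖ(Z_M)`, by Cartan's formula (`IsSmoothAction.d_generator`).

*The two factors cancel.* The moment of the canonical form of `T^*G` is `-leftMoment`, because
`k(p)` has base point `g k⁻¹` if `p` has base point `g` (`formMoment_canonicalForm`). So on `C` the
moments of `T^*G` and of `Y` are opposite, and hence so are the changes of the two pull-backs.

The smoothness of all the objects involved is that of pull-backs of smooth forms and of their
exterior derivatives (`MForm.IsSmooth.contDiffAt_pullback`, `MForm.IsSmooth.contDiffAt_pullback_d`),
and of the canonical form and the right translations of `T^*G` in bundle charts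
(`isSmooth_canonicalForm`, `contMDiff_rightTranslate`).
-/

noncomputable section

namespace Induction

/-! ### Smoothness of pull-backs of alternating maps -/

section Alternating

variable {V W : Type*} [NormedAddCommGroup V] [NormedSpace ℝ V] [NormedAddCommGroup W]
  [NormedSpace ℝ W] {k : ℕ}

theorem continuous_alternatization :
    Continuous (ContinuousMultilinearMap.alternatization (R := ℝ) (M := V) (N := ℝ)
      (ι := Fin k)) := by
  rw [ContinuousAlternatingMap.isEmbedding_toContinuousMultilinearMap.continuous_iff]
  have h : (ContinuousAlternatingMap.toContinuousMultilinearMap ∘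
      (ContinuousMultilinearMap.alternatization (R := ℝ) (M := V) (N := ℝ) (ι := Fin k))) =
      fun f => ∑ σ : Equiv.Perm (Fin k), Equiv.Perm.sign σ •
        ContinuousMultilinearMap.domDomCongrₗᵢ ℝ V ℝ σ f := rfl
  rw [h]
  refine continuous_finsetSum _ fun σ _ => ?_
  rcases Int.units_eq_one_or (Equiv.Perm.sign σ) with hσ | hσ
  · simp only [hσ, one_smul]
    exact LinearIsometryEquiv.continuous _
  · simp only [hσ, Units.neg_smul, one_smul]
    exact (LinearIsometryEquiv.continuous _).neg

/-- On alternating maps, alternatization is multiplication by `k!`. Hence the inclusion of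
alternating maps into multilinear maps has a continuous linear left inverse, and smoothness of a
family of alternating maps may be tested in the space of multilinear maps. -/
theorem alternatization_toContinuousMultilinearMap (η : V [⋀^Fin k]→L[ℝ] ℝ) :
    ContinuousMultilinearMap.alternatization η.toContinuousMultilinearMap =
      (k.factorial : ℝ) • η := by
  ext v
  rw [ContinuousMultilinearMap.alternatization_apply_apply]
  have h : ∀ σ : Equiv.Perm (Fin k), Equiv.Perm.sign σ • η.toContinuousMultilinearMap (v ∘ σ) =
      η v := fun σ => by
    change Equiv.Perm.sign σ • η (v ∘ σ) = η v
    have hp : η (v ∘ σ) = Equiv.Perm.sign σ • η v := η.toAlternatingMap.map_perm v σ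
    rw [hp, smul_smul, Int.units_mul_self, one_smul]
  rw [Finset.sum_congr rfl fun σ _ => h σ]
  simp [Fintype.card_perm]

theorem contDiffAt_of_toContinuousMultilinearMap {U : Type*} [NormedAddCommGroup U]
    [NormedSpace ℝ U] {n : WithTop ℕ∞} {η : U → V [⋀^Fin k]→L[ℝ] ℝ} {u : U}
    (h : ContDiffAt ℝ n (fun x => (η x).toContinuousMultilinearMap) u) : ContDiffAt ℝ n η u := by
  let A := AddMonoidHom.toRealLinearMap _ (continuous_alternatization (V := V) (k := k))
  have hA : η = fun x => (k.factorial : ℝ)⁻¹ • A (η x).toContinuousMultilinearMap := by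
    funext x
    change _ = _ • ContinuousMultilinearMap.alternatization _
    rw [alternatization_toContinuousMultilinearMap, smul_smul, inv_mul_cancel₀, one_smul]
    exact_mod_cast k.factorial_ne_zero
  rw [hA]
  exact (A.contDiff.contDiffAt.comp u h).const_smul _

theorem contDiff_compContinuousLinearMapL {ι : Type*} [Fintype ι] {n : WithTop ℕ∞}
    (V W : ι → Type*) [∀ i, NormedAddCommGroup (V i)] [∀ i, NormedSpace ℝ (V i)]
    [∀ i, NormedAddCommGroup (W i)] [∀ i, NormedSpace ℝ (W i)] :
    ContDiff ℝ n fun L : ∀ i, V i →L[ℝ] W i =>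
      ContinuousMultilinearMap.compContinuousLinearMapL (F := ℝ) L :=
  ContinuousMultilinearMap.contDiff (𝕜 := ℝ) (E := fun i => V i →L[ℝ] W i)
    (F := ContinuousMultilinearMap ℝ W ℝ →L[ℝ] ContinuousMultilinearMap ℝ V ℝ)
    (ContinuousMultilinearMap.compContinuousLinearMapContinuousMultilinear ℝ V W ℝ)

theorem _root_.ContDiffAt.compContinuousLinearMap {U : Type*} [NormedAddCommGroup U]
    [NormedSpace ℝ U] {n : WithTop ℕ∞} {η : U → W [⋀^Fin k]→L[ℝ] ℝ} {L : U → V →L[ℝ] W} {u : U}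
    (hη : ContDiffAt ℝ n η u) (hL : ContDiffAt ℝ n L u) :
    ContDiffAt ℝ n (fun x => (η x).compContinuousLinearMap (L x)) u := by
  refine contDiffAt_of_toContinuousMultilinearMap ?_
  have h1 : ContDiffAt ℝ n (fun x => (η x).toContinuousMultilinearMap) u :=
    ContDiffAt.comp u (ContinuousAlternatingMap.toContinuousMultilinearMapLI (𝕜 := ℝ) (E := W)
      (F := ℝ) (ι := Fin k)).contDiff.contDiffAt hη
  have h2 := (contDiff_compContinuousLinearMapL (n := n) (fun _ : Fin k => V)
    (fun _ : Fin k => W)).contDiffAt.comp u (contDiffAt_pi.2 fun _ : Fin k => hL)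
  exact h2.clm_apply h1

theorem contDiff_ofSubsingleton {n : WithTop ℕ∞} :
    ContDiff ℝ n fun L : V →L[ℝ] ℝ =>
      ContinuousAlternatingMap.ofSubsingleton ℝ V ℝ (0 : Fin 1) L :=
  (ContinuousAlternatingMap.ofSubsingletonLIE (𝕜 := ℝ) (E := V) (F := ℝ) (0 : Fin 1)).contDiff

end Alternating

/-! ### Pull-backs and exterior derivatives of forms on manifolds -/

section Naturality

variable {E : Type*} [NormedAddCommGroup E] [NormedSpace ℝ E] {A : Type*} [TopologicalSpace A]
  {I : ModelWithCorners ℝ E A} {M : Type*} [TopologicalSpace M] [ChartedSpace A M]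
  {E' : Type*} [NormedAddCommGroup E'] [NormedSpace ℝ E'] {A' : Type*} [TopologicalSpace A']
  {I' : ModelWithCorners ℝ E' A'} {M' : Type*} [TopologicalSpace M'] [ChartedSpace A' M']
  {E'' : Type*} [NormedAddCommGroup E''] [NormedSpace ℝ E''] {A'' : Type*} [TopologicalSpace A'']
  {I'' : ModelWithCorners ℝ E'' A''} {M'' : Type*} [TopologicalSpace M''] [ChartedSpace A'' M'']
  {V : Type*} [NormedAddCommGroup V] [NormedSpace ℝ V] {k : ℕ}

theorem MForm.pullback_comp_apply {f : M → M'} {g : M' → M''} (σ : MForm I'' M'' k) {x : M}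
    (hg : MDifferentiableAt I' I'' g (f x)) (hf : MDifferentiableAt I I' f x) :
    MForm.pullback I I'' (g ∘ f) σ x =
      (MForm.pullback I' I'' g σ (f x)).compContinuousLinearMap (mfderiv I I' f x) := by
  unfold MForm.pullback
  rw [mfderiv_comp x hg hf]
  rfl

theorem MForm.pullback_congr {f g : M → M'} (σ : MForm I' M' k) {x : M} (h : f =ᶠ[𝓝 x] g) :
    MForm.pullback I I' f σ x = MForm.pullback I I' g σ x := by
  unfold MForm.pullback
  rw [h.mfderiv_eq]
  have h' : ∀ (a b : M') (L : E →L[ℝ] E'), a = b →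
      (σ a : E' [⋀^Fin k]→L[ℝ] ℝ).compContinuousLinearMap L =
        (σ b : E' [⋀^Fin k]→L[ℝ] ℝ).compContinuousLinearMap L := by
    rintro a _ L rfl
    rfl
  exact h' _ _ _ h.self_of_nhds

theorem mdifferentiableAt_of_contMDiffAt {f : M → M'} {x : M} (hf : ContMDiffAt I I' ∞ f x) :
    MDifferentiableAt I I' f x :=
  hf.mdifferentiableAt (by simp)

/-- The pull-back of a form on a manifold to a vector space, as a form on that vector space. -/
def MForm.onSpace (I : ModelWithCorners ℝ E A) {M : Type*} [TopologicalSpace M] [ChartedSpace A M]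
    {k : ℕ} (σ : MForm I M k) (f : V → M) : V → V [⋀^Fin k]→L[ℝ] ℝ :=
  MForm.pullback 𝓘(ℝ, V) I f σ

theorem MForm.IsSmooth.contDiffAt_inChart {σ : MForm I M k} (hσ : MForm.IsSmooth I σ)
    [I.Boundaryless] (x : M) :
    ContDiffAt ℝ ∞ (MForm.inChart I σ x) (extChartAt I x x) :=
  (hσ x).contDiffAt (extChartAt_target_mem_nhds x)

theorem eventually_mdifferentiableAt [IsManifold I ∞ M] {f : V → M} {x : V}
    (hf : ContMDiffAt 𝓘(ℝ, V) I ∞ f x) :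
    ∀ᶠ z in 𝓝 x, MDifferentiableAt 𝓘(ℝ, V) I f z := by
  have h1 : ContMDiffAt 𝓘(ℝ, V) I 1 f x := hf.of_le (by exact_mod_cast le_top)
  have h2 := (contMDiffAt_iff_contMDiffAt_nhds (by simp)).1 h1
  filter_upwards [h2] with z hz using hz.mdifferentiableAt (by simp)

theorem contDiffAt_chart_comp [IsManifold I ∞ M] {f : V → M} {u : V}
    (hf : ContMDiffAt 𝓘(ℝ, V) I ∞ f u) :
    ContDiffAt ℝ ∞ (fun z => extChartAt I (f u) (f z)) u := by
  rw [← contMDiffAt_iff_contDiffAt]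
  exact (contMDiffAt_extChartAt (n := ∞)).comp u hf

variable [IsManifold I ∞ M] [I.Boundaryless]

theorem contMDiffAt_extChartAt_symm_of_boundaryless {x₀ : M} {z : E}
    (hz : z ∈ (extChartAt I x₀).target) :
    ContMDiffAt 𝓘(ℝ, E) I ∞ (extChartAt I x₀).symm z :=
  (contMDiffOn_extChartAt_symm x₀).contMDiffAt ((isOpen_extChartAt_target x₀).mem_nhds hz)

/-- In the chart at a point of its image, the pull-back of a form on a manifold is the pull-back
of the form in the chart. -/
theorem MForm.pullback_eventuallyEq_inChart (σ : MForm I M k) {f : V → M} {u : V}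
    (hf : ContMDiffAt 𝓘(ℝ, V) I ∞ f u) :
    MForm.onSpace I σ f =ᶠ[𝓝 u] fun z =>
      (MForm.inChart I σ (f u) (extChartAt I (f u) (f z))).compContinuousLinearMap
        (fderiv ℝ (fun z => extChartAt I (f u) (f z)) z) := by
  filter_upwards [eventually_mdifferentiableAt hf, (hf.continuousAt.eventually
    (extChartAt_source_mem_nhds (I := I) (f u))).eventually_nhds] with z hz hs
  have hzs := hs.self_of_nhds
  have h1 : MDifferentiableAt 𝓘(ℝ, V) 𝓘(ℝ, E) (extChartAt I (f u) ∘ f) z :=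
    (mdifferentiableAt_extChartAt (by rwa [← extChartAt_source (I := I)])).comp z hz
  have h2 : MDifferentiableAt 𝓘(ℝ, E) I (extChartAt I (f u)).symm
      ((extChartAt I (f u) ∘ f) z) :=
    mdifferentiableAt_of_contMDiffAt (contMDiffAt_extChartAt_symm_of_boundaryless
      ((extChartAt I (f u)).map_source hzs))
  have h3 := MForm.pullback_comp_apply σ h2 h1
  have h4 : f =ᶠ[𝓝 z] (extChartAt I (f u)).symm ∘ (extChartAt I (f u) ∘ f) := by
    filter_upwards [hs] with w hw
    exact ((extChartAt I (f u)).left_inv hw).symm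
  rw [MForm.onSpace, MForm.pullback_congr σ h4, h3, mfderiv_eq_fderiv]
  rfl

/-- The pull-back of a smooth form by a smooth map is smooth. -/
theorem MForm.IsSmooth.contDiffAt_pullback {σ : MForm I M k} (hσ : MForm.IsSmooth I σ)
    {f : V → M} {u : V} (hf : ContMDiffAt 𝓘(ℝ, V) I ∞ f u) :
    ContDiffAt ℝ ∞ (MForm.onSpace I σ f) u := by
  refine ContDiffAt.congr_of_eventuallyEq ?_ (MForm.pullback_eventuallyEq_inChart σ hf)
  have h := contDiffAt_chart_comp hf
  have h1 : ContDiffAt ℝ ∞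
      (fun z => MForm.inChart I σ (f u) (extChartAt I (f u) (f z))) u :=
    ContDiffAt.comp u (hσ.contDiffAt_inChart (f u)) h
  exact h1.compContinuousLinearMap (h.fderiv_right le_rfl)

/-- The exterior derivative commutes with pull-backs to vector spaces. -/
theorem MForm.IsSmooth.pullback_d {σ : MForm I M k} (hσ : MForm.IsSmooth I σ) {f : V → M} {u : V}
    (hf : ContMDiffAt 𝓘(ℝ, V) I ∞ f u) :
    MForm.onSpace I (MForm.d I σ) f u =
      extDeriv (MForm.onSpace I σ f) u := by
  rw [(MForm.pullback_eventuallyEq_inChart σ hf).extDeriv_eq,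
    extDeriv_pullback (f := fun z => extChartAt I (f u) (f z))
      ((hσ.contDiffAt_inChart (f u)).differentiableAt (by simp)) (contDiffAt_chart_comp hf)
      (by simpa using (WithTop.coe_le_coe.2 le_top : ((2 : ℕ∞) : WithTop ℕ∞) ≤ ∞)),
    ← mfderiv_eq_fderiv]
  have h : mfderiv 𝓘(ℝ, V) 𝓘(ℝ, E) (extChartAt I (f u) ∘ f) u =
      (mfderiv I 𝓘(ℝ, E) (extChartAt I (f u)) (f u)).comp (mfderiv 𝓘(ℝ, V) I f u) :=
    mfderiv_comp u (mdifferentiableAt_extChartAt (mem_chart_source A (f u)))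
      (mdifferentiableAt_of_contMDiffAt hf)
  change _ = ContinuousAlternatingMap.compContinuousLinearMap _
    (mfderiv 𝓘(ℝ, V) 𝓘(ℝ, E) (extChartAt I (f u) ∘ f) u)
  rw [h]
  rfl

/-- The exterior derivative of a smooth form has smooth pull-backs. -/
theorem MForm.IsSmooth.contDiffAt_pullback_d {σ : MForm I M k} (hσ : MForm.IsSmooth I σ)
    {f : V → M} (hf : ContMDiff 𝓘(ℝ, V) I ∞ f) (u : V) :
    ContDiffAt ℝ ∞ (MForm.onSpace I (MForm.d I σ) f) u := by
  have h : MForm.onSpace I (MForm.d I σ) f =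
      extDeriv (MForm.onSpace I σ f) := by
    funext z
    exact hσ.pullback_d (hf z)
  rw [h]
  exact (ContinuousAlternatingMap.alternatizeUncurryFinCLM ℝ V ℝ).contDiff.contDiffAt.comp u
    ((hσ.contDiffAt_pullback (hf u)).fderiv_right (m := ∞) le_rfl)

/-- The exterior derivative of an invariant form is invariant. -/
theorem MForm.IsSmooth.pullback_d_self {σ : MForm I M k} (hσ : MForm.IsSmooth I σ) {f : M → M}
    (hf : ContMDiff I I ∞ f) (h : MForm.pullback I I f σ = σ) :
    MForm.pullback I I f (MForm.d I σ) = MForm.d I σ := by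
  funext x
  set φ := extChartAt I x
  have hsymm : ∀ z ∈ φ.target, ContMDiffAt 𝓘(ℝ, E) I ∞ φ.symm z := fun z hz =>
    contMDiffAt_extChartAt_symm_of_boundaryless hz
  have hφx : φ x ∈ φ.target := mem_extChartAt_target x
  have key : MForm.onSpace I σ (f ∘ φ.symm) =ᶠ[𝓝 (φ x)]
      MForm.onSpace I σ φ.symm := by
    filter_upwards [extChartAt_target_mem_nhds x] with z hz
    rw [MForm.onSpace, MForm.pullback_comp_apply σ (mdifferentiableAt_of_contMDiffAt (hf _))
      (mdifferentiableAt_of_contMDiffAt (hsymm z hz)), h]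
    rfl
  have h1 := hσ.pullback_d (f := f ∘ φ.symm) (u := φ x)
    ((hf _).comp (φ x) (hsymm _ hφx))
  rw [key.extDeriv_eq, MForm.onSpace] at h1
  have h2 : f =ᶠ[𝓝 x] (f ∘ φ.symm) ∘ φ := by
    filter_upwards [extChartAt_source_mem_nhds (I := I) x] with w hw
    simp only [Function.comp_apply]
    rw [φ.left_inv hw]
  rw [MForm.pullback_congr _ h2, MForm.pullback_comp_apply (I' := 𝓘(ℝ, E)) (MForm.d I σ)
    ((mdifferentiableAt_of_contMDiffAt (hf _)).comp (φ x)
      (mdifferentiableAt_of_contMDiffAt (hsymm _ hφx)))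
    (mdifferentiableAt_extChartAt (mem_chart_source A x)), h1]
  rfl

end Naturality

/-! ### Derivatives and values of forms in the model space -/

section Coordinates

variable {E : Type*} [NormedAddCommGroup E] [NormedSpace ℝ E] {A : Type*} [TopologicalSpace A]
  {I : ModelWithCorners ℝ E A} {M : Type*} [TopologicalSpace M] [ChartedSpace A M]
  {E' : Type*} [NormedAddCommGroup E'] [NormedSpace ℝ E'] {A' : Type*} [TopologicalSpace A']
  {I' : ModelWithCorners ℝ E' A'} {M' : Type*} [TopologicalSpace M'] [ChartedSpace A' M']
  {E'' : Type*} [NormedAddCommGroup E''] [NormedSpace ℝ E''] {A'' : Type*} [TopologicalSpace A'']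
  {I'' : ModelWithCorners ℝ E'' A''} {M'' : Type*} [TopologicalSpace M''] [ChartedSpace A'' M'']
  {V : Type*} [NormedAddCommGroup V] [NormedSpace ℝ V] {n : ℕ}

/-- The value of a form at a point, as an alternating map on the model space. The type does not
depend on the point, so that equal points may be substituted for each other. -/
def MForm.val (σ : MForm I M n) (x : M) : E [⋀^Fin n]→L[ℝ] ℝ := σ x

variable (I I') in
/-- The derivative of a map of manifolds, as a linear map between the model spaces. -/
def modelDeriv (f : M → M') (x : M) : E →L[ℝ] E' := mfderiv I I' f x

theorem modelDeriv_comp {g : M' → M''} {f : M → M'} {x : M} {y : M'}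
    (hg : MDifferentiableAt I' I'' g y) (hf : MDifferentiableAt I I' f x) (hy : f x = y) :
    modelDeriv I I'' (fun z => g (f z)) x =
      (modelDeriv I' I'' g y).comp (modelDeriv I I' f x) := by
  subst hy
  exact mfderiv_comp x hg hf

theorem modelDeriv_congr {f g : M → M'} {x : M} (h : f =ᶠ[𝓝 x] g) :
    modelDeriv I I' f x = modelDeriv I I' g x :=
  h.mfderiv_eq

@[simp]
theorem modelDeriv_id (x : M) : modelDeriv I I (fun z => z) x = ContinuousLinearMap.id ℝ E :=
  mfderiv_id

@[simp]
theorem modelDeriv_const (x : M) (y : M') : modelDeriv I I' (fun _ => y) x = 0 :=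
  mfderiv_const

theorem modelDeriv_eq_fderiv (f : V → E) (x : V) :
    modelDeriv 𝓘(ℝ, V) 𝓘(ℝ, E) f x = fderiv ℝ f x :=
  mfderiv_eq_fderiv

/-- The derivative of a map of two variables is the sum of the partial derivatives. -/
theorem modelDeriv_comp_prodMk
    {EN : Type*} [NormedAddCommGroup EN] [NormedSpace ℝ EN]
    {AN : Type*} [TopologicalSpace AN] {J : ModelWithCorners ℝ EN AN} {N : Type*}
    [TopologicalSpace N] [ChartedSpace AN N]
    {f : M' × M'' → M} {a : N → M'} {b : N → M''} {u : N}
    (hf : MDifferentiableAt (I'.prod I'') I f (a u, b u))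
    (ha : MDifferentiableAt J I' a u) (hb : MDifferentiableAt J I'' b u) (v : EN) :
    modelDeriv J I (fun z => f (a z, b z)) u v =
      modelDeriv I' I (fun z => f (z, b u)) (a u) (modelDeriv J I' a u v) +
        modelDeriv I'' I (fun z => f (a u, z)) (b u) (modelDeriv J I'' b u v) := by
  have h1 : mfderiv J I (f ∘ fun z => (a z, b z)) u =
      (mfderiv (I'.prod I'') I f (a u, b u)).comp
        (mfderiv J (I'.prod I'') (fun z => (a z, b z)) u) :=
    mfderiv_comp u hf (ha.prodMk hb)
  rw [mfderiv_prodMk ha hb] at h1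
  unfold modelDeriv
  change mfderiv J I (f ∘ fun z => (a z, b z)) u v = _
  rw [h1]
  exact mfderiv_prod_eq_add_apply hf

theorem MForm.onSpace_apply (σ : MForm I M n) (f : V → M) (u : V) (v : Fin n → V) :
    MForm.onSpace I σ f u v = σ.val (f u) fun i => modelDeriv 𝓘(ℝ, V) I f u (v i) :=
  rfl

theorem MForm.val_modelDeriv {σ : MForm I M n} {f : M → M}
    (h : MForm.pullback I I f σ = σ) (x : M) (v : Fin n → E) :
    (σ.val (f x) fun i => modelDeriv I I f x (v i)) = σ.val x v := by
  conv_rhs => rw [← h]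
  rfl

variable [IsManifold I 1 M]

theorem modelDeriv_extChartAt (x : M) :
    modelDeriv I 𝓘(ℝ, E) (extChartAt I x) x = ContinuousLinearMap.id ℝ E :=
  mfderiv_extChartAt_self

theorem modelDeriv_extChartAt_symm [I.Boundaryless] (x : M) :
    modelDeriv 𝓘(ℝ, E) I (extChartAt I x).symm (extChartAt I x x) =
      ContinuousLinearMap.id ℝ E := by
  have h := mfderivWithin_range_extChartAt_symm (I := I) (x := x)
  rw [I.range_eq_univ, mfderivWithin_univ] at h
  exact h

/-- Every tangent vector is the velocity of a smooth curve. -/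
theorem exists_curve [IsManifold I ∞ M] [I.Boundaryless] (x : M) (Z : E) :
    ∃ c : ℝ → M, c 0 = x ∧ ContMDiffAt 𝓘(ℝ, ℝ) I ∞ c 0 ∧
      modelDeriv 𝓘(ℝ, ℝ) I c 0 1 = Z := by
  have hl : ContDiff ℝ ∞ (fun s : ℝ => extChartAt I x x + s • Z) :=
    contDiff_const.add (contDiff_id.smul contDiff_const)
  have h0 : extChartAt I x x + (0 : ℝ) • Z = extChartAt I x x := by simp
  have hs : ContMDiffAt 𝓘(ℝ, E) I ∞ (extChartAt I x).symm (extChartAt I x x) :=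
    contMDiffAt_extChartAt_symm_of_boundaryless (mem_extChartAt_target x)
  refine ⟨fun s => (extChartAt I x).symm (extChartAt I x x + s • Z), ?_, ?_, ?_⟩
  · simp only [h0, extChartAt_to_inv]
  · exact ContMDiffAt.comp_of_eq hs hl.contMDiff.contMDiffAt h0
  · rw [modelDeriv_comp (mdifferentiableAt_of_contMDiffAt hs)
      (hl.contMDiff.mdifferentiableAt (by simp)) h0, modelDeriv_extChartAt_symm,
      modelDeriv_eq_fderiv]
    have hd : HasFDerivAt (fun s : ℝ => extChartAt I x x + s • Z)
        (ContinuousLinearMap.toSpanSingleton ℝ Z) 0 :=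
      ((ContinuousLinearMap.toSpanSingleton ℝ Z).hasFDerivAt (x := 0)).const_add
        (extChartAt I x x)
    rw [hd.fderiv]
    simp

end Coordinates

/-! ### Smooth actions and invariant forms -/

section Actions

variable {F : Type*} [NormedAddCommGroup F] [NormedSpace ℝ F]
  {K : Type*} [Group K] [TopologicalSpace K] [ChartedSpace F K]
  {E : Type*} [NormedAddCommGroup E] [NormedSpace ℝ E] {A : Type*} [TopologicalSpace A]
  {I : ModelWithCorners ℝ E A} {M : Type*} [TopologicalSpace M] [ChartedSpace A M]
  {V : Type*} [NormedAddCommGroup V] [NormedSpace ℝ V] {n : ℕ}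

variable (F I) in
/-- A smooth left action of the Lie group `K` on the manifold `M`, given as a function so that it
applies to actions which are not instances. -/
structure IsSmoothAction (act : K → M → M) : Prop where
  smooth : ContMDiff (𝓘(ℝ, F).prod I) I ∞ (fun x : K × M => act x.1 x.2)
  one_act : ∀ x, act 1 x = x
  mul_act : ∀ k l x, act (k * l) x = act k (act l x)

variable (F I) in
/-- The infinitesimal action `Z ↦ Z_M(x)` of the Lie algebra of `K`. -/
def generator (act : K → M → M) (x : M) : F →L[ℝ] E :=
  modelDeriv 𝓘(ℝ, F) I (fun k : K => act k x) 1

variable (F) in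
/-- The left logarithmic derivative `k⁻¹ dk` of a map into a Lie group. -/
def leftLogDeriv (k : V → K) (u : V) : V →L[ℝ] F :=
  modelDeriv 𝓘(ℝ, V) 𝓘(ℝ, F) (fun z => (k u)⁻¹ * k z) u

namespace IsSmoothAction

variable {act : K → M → M}

theorem contMDiff_act (hact : IsSmoothAction F I act) (k : K) : ContMDiff I I ∞ (act k) :=
  hact.smooth.comp (contMDiff_const.prodMk contMDiff_id)

theorem mdifferentiableAt_act (hact : IsSmoothAction F I act) (k : K) (x : M) :
    MDifferentiableAt I I (act k) x :=
  (hact.contMDiff_act k).mdifferentiableAt (by simp)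

theorem contMDiff_orbit (hact : IsSmoothAction F I act) (x : M) :
    ContMDiff 𝓘(ℝ, F) I ∞ (fun k => act k x) :=
  hact.smooth.comp (contMDiff_id.prodMk contMDiff_const)

theorem modelDeriv_of_eq_one (hact : IsSmoothAction F I act) {k : V → K} {q : V → M} {u : V}
    (hk : MDifferentiableAt 𝓘(ℝ, V) 𝓘(ℝ, F) k u) (hq : MDifferentiableAt 𝓘(ℝ, V) I q u)
    (hu : k u = 1) (v : V) :
    modelDeriv 𝓘(ℝ, V) I (fun z => act (k z) (q z)) u v =
      generator F I act (q u) (modelDeriv 𝓘(ℝ, V) 𝓘(ℝ, F) k u v) +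
        modelDeriv 𝓘(ℝ, V) I q u v := by
  have h := modelDeriv_comp_prodMk (f := fun x : K × M => act x.1 x.2)
    (hact.smooth.mdifferentiableAt (by simp)) hk hq v
  simp only [hu, hact.one_act, modelDeriv_id] at h
  exact h

/-- The infinitesimal action is equivariant. -/
theorem generator_act [LieGroup 𝓘(ℝ, F) ∞ K] (hact : IsSmoothAction F I act) (k : K) (x : M)
    (Z : F) :
    generator F I act (act k x) Z =
      modelDeriv I I (act k) x (generator F I act x (Ad F k⁻¹ Z)) := by
  have hc : ContMDiff 𝓘(ℝ, F) 𝓘(ℝ, F) ∞ (fun l : K => k⁻¹ * l * k⁻¹⁻¹) :=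
    (contMDiff_const.mul contMDiff_id).mul contMDiff_const
  have h1 : (fun l => act l (act k x)) = fun l => act k (act (k⁻¹ * l * k⁻¹⁻¹) x) := by
    funext l
    simp only [← hact.mul_act]
    congr 1
    group
  have h2 : k⁻¹ * 1 * k⁻¹⁻¹ = 1 := by group
  unfold generator
  rw [h1, modelDeriv_comp (hact.mdifferentiableAt_act k x)
      (f := fun l => act (k⁻¹ * l * k⁻¹⁻¹) x)
      (((hact.contMDiff_orbit x).comp hc).mdifferentiableAt (by simp))
      (by simp only [h2, hact.one_act]),
    modelDeriv_comp ((hact.contMDiff_orbit x).mdifferentiableAt (by simp))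
      (hc.mdifferentiableAt (by simp)) h2]
  rfl

/-- The pull-back of an invariant form when a plot `q` is moved by a plot `k` of the
group: translating by `k(u)⁻¹` reduces to `k(u) = 1`, where the velocities change by values of the
infinitesimal action. -/
theorem onSpace_act [LieGroup 𝓘(ℝ, F) ∞ K] (hact : IsSmoothAction F I act) {σ : MForm I M n}
    (hσ : ∀ g, MForm.pullback I I (act g) σ = σ)
    {k : V → K} {q q' : V → M} {u : V} (hk : MDifferentiableAt 𝓘(ℝ, V) 𝓘(ℝ, F) k u)
    (hq : MDifferentiableAt 𝓘(ℝ, V) I q u) (hq' : ∀ᶠ z in 𝓝 u, q' z = act (k z) (q z))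
    (v : Fin n → V) :
    MForm.onSpace I σ q' u v =
      σ.val (q u) fun i => generator F I act (q u) (leftLogDeriv F k u (v i)) +
        modelDeriv 𝓘(ℝ, V) I q u (v i) := by
  have hk' : MDifferentiableAt 𝓘(ℝ, V) 𝓘(ℝ, F) (fun z => (k u)⁻¹ * k z) u :=
    ((contMDiff_mul_left (I := 𝓘(ℝ, F)) (n := ∞) (a := (k u)⁻¹)).mdifferentiableAt
      (by simp)).comp u hk
  have hk1 : (k u)⁻¹ * k u = 1 := inv_mul_cancel _
  have hd : MDifferentiableAt 𝓘(ℝ, V) I (fun z => act ((k u)⁻¹ * k z) (q z)) u :=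
    MDifferentiableAt.comp u (f := fun z => ((k u)⁻¹ * k z, q z))
      (g := fun x : K × M => act x.1 x.2)
      (hact.smooth.mdifferentiableAt (by simp)) (hk'.prodMk hq)
  have h1 : q' =ᶠ[𝓝 u] act (k u) ∘ fun z => act ((k u)⁻¹ * k z) (q z) := by
    filter_upwards [hq'] with z hz
    rw [hz, Function.comp_apply, ← hact.mul_act, mul_inv_cancel_left]
  have h2 : MForm.onSpace I σ q' u =
      MForm.onSpace I σ (fun z => act ((k u)⁻¹ * k z) (q z)) u := by
    rw [MForm.onSpace, MForm.pullback_congr σ h1, MForm.pullback_comp_apply σ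
      (hact.mdifferentiableAt_act (k u) _) hd, hσ]
    rfl
  rw [h2, MForm.onSpace_apply, hk1, hact.one_act]
  congr 1
  funext i
  exact hact.modelDeriv_of_eq_one hk' hq hk1 (v i)

end IsSmoothAction

/-- The function `Z ↦ τ(Z_M(x))` attached to an invariant `1`-form `τ`. -/
def formMoment (act : K → M → M) (τ : MForm I M 1) (x : M) (Z : F) : ℝ :=
  τ.val x ![generator F I act x Z]

theorem extDeriv_oneForm_apply {η : V → V [⋀^Fin 1]→L[ℝ] ℝ} {x : V}
    (hη : DifferentiableAt ℝ η x) (v w : V) :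
    extDeriv η x ![v, w] =
      fderiv ℝ (fun z => η z ![w]) x v - fderiv ℝ (fun z => η z ![v]) x w := by
  rw [extDeriv_apply hη, Fin.sum_univ_two]
  have h0 : (0 : Fin 2).removeNth ![v, w] = ![w] := by
    ext i; fin_cases i; rfl
  have h1 : (1 : Fin 2).removeNth ![v, w] = ![v] := by
    ext i; fin_cases i; rfl
  rw [h0, h1]
  simp [sub_eq_add_neg]

namespace IsSmoothAction

variable {act : K → M → M}

theorem formMoment_act [LieGroup 𝓘(ℝ, F) ∞ K] (hact : IsSmoothAction F I act) {τ : MForm I M 1}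
    (hτ : ∀ g, MForm.pullback I I (act g) τ = τ) (k : K) (x : M) (Z : F) :
    formMoment act τ (act k x) Z = formMoment act τ x (Ad F k⁻¹ Z) := by
  unfold formMoment
  rw [hact.generator_act, ← MForm.val_modelDeriv (hτ k) x]
  congr 1
  ext i
  fin_cases i
  rfl

/-- Cartan's formula for the infinitesimal action on an invariant `1`-form. The form is pulled
back by `(s, a) ↦ c(s) φ⁻¹(a)`, where `c` is a curve in `K` with velocity `Z` at `c 0 = 1` and `φ`
is a chart: its value on `∂/∂a` does not depend on `s`, by invariance, and its value on `∂/∂s` at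
`s = 0` is the moment. -/
theorem d_generator [LieGroup 𝓘(ℝ, F) ∞ K] [IsManifold I ∞ M] [I.Boundaryless]
    (hact : IsSmoothAction F I act) {τ : MForm I M 1} (hτs : MForm.IsSmooth I τ)
    (hτ : ∀ g, MForm.pullback I I (act g) τ = τ) (x : M) (Z : F) :
    MDifferentiableAt I 𝓘(ℝ, ℝ) (fun y => formMoment act τ y Z) x ∧
      ∀ w : E, (MForm.d I τ).val x ![generator F I act x Z, w] =
        - modelDeriv I 𝓘(ℝ, ℝ) (fun y => formMoment act τ y Z) x w := by
  obtain ⟨c, hc0, hc, hcZ⟩ := exists_curve (I := 𝓘(ℝ, F)) (1 : K) Z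
  set φ := extChartAt I x
  have hφx : φ.symm (φ x) = x := extChartAt_to_inv x
  have hφ : ∀ z ∈ φ.target, ContMDiffAt 𝓘(ℝ, E) I ∞ φ.symm z := fun z hz =>
    contMDiffAt_extChartAt_symm_of_boundaryless hz
  have hφt : ∀ᶠ z in 𝓝 (φ x), z ∈ φ.target := extChartAt_target_mem_nhds x
  set p : ℝ × E := (0, φ x)
  let Φ : ℝ × E → M := fun z => act (c z.1) (φ.symm z.2)
  have hc' : ∀ a : E, ContMDiffAt 𝓘(ℝ, ℝ × E) 𝓘(ℝ, F) ∞ (fun z : ℝ × E => c z.1) (0, a) :=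
    fun a => ContMDiffAt.comp (0, a) (f := Prod.fst) hc contDiff_fst.contMDiff.contMDiffAt
  have hφ' : ∀ s : ℝ, ∀ a ∈ φ.target,
      ContMDiffAt 𝓘(ℝ, ℝ × E) I ∞ (fun z : ℝ × E => φ.symm z.2) (s, a) :=
    fun s a ha => ContMDiffAt.comp (s, a) (f := Prod.snd) (hφ a ha)
      contDiff_snd.contMDiff.contMDiffAt
  have hΦ : ∀ a ∈ φ.target, ContMDiffAt 𝓘(ℝ, ℝ × E) I ∞ Φ (0, a) := fun a ha =>
    ContMDiffAt.comp (0, a) (g := fun x : K × M => act x.1 x.2) hact.smooth.contMDiffAt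
      ((hc' a).prodMk (hφ' 0 a ha))
  have hφxt : φ x ∈ φ.target := mem_extChartAt_target x
  have hdΦ : ∀ a ∈ φ.target, ∀ (s : ℝ) (w : E), modelDeriv 𝓘(ℝ, ℝ × E) I Φ (0, a) (s, w) =
      generator F I act (φ.symm a) (s • Z) + modelDeriv 𝓘(ℝ, E) I φ.symm a w := by
    intro a ha s w
    rw [hact.modelDeriv_of_eq_one (mdifferentiableAt_of_contMDiffAt (hc' a))
      (mdifferentiableAt_of_contMDiffAt (hφ' 0 a ha)) hc0,
      modelDeriv_comp (f := (Prod.fst : ℝ × E → ℝ)) (mdifferentiableAt_of_contMDiffAt hc)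
        (contDiff_fst (n := ∞).contMDiff.mdifferentiableAt (by simp)) rfl,
      modelDeriv_comp (f := (Prod.snd : ℝ × E → E)) (mdifferentiableAt_of_contMDiffAt (hφ a ha))
        (contDiff_snd (n := ∞).contMDiff.mdifferentiableAt (by simp)) rfl,
      modelDeriv_eq_fderiv, modelDeriv_eq_fderiv, fderiv_fst, fderiv_snd]
    simp only [ContinuousLinearMap.comp_apply, ContinuousLinearMap.coe_fst',
      ContinuousLinearMap.coe_snd']
    congr 2
    rw [← hcZ, ← map_smul, smul_eq_mul, mul_one]
  let β : ℝ × E → (ℝ × E) [⋀^Fin 1]→L[ℝ] ℝ := MForm.onSpace I τ Φ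
  have hβ : ContDiffAt ℝ ∞ β p := hτs.contDiffAt_pullback (hΦ _ hφxt)
  have hβd : ∀ v, DifferentiableAt ℝ (fun z => β z v) p := fun v =>
    (hβ.differentiableAt (by simp)).continuousAlternatingMap_apply_const v
  -- the value on `∂/∂s` along `s = 0`
  have hs : (fun a => formMoment act τ (φ.symm a) Z) =ᶠ[𝓝 (φ x)]
      fun a => β (0, a) ![((1 : ℝ), (0 : E))] := by
    filter_upwards [hφt] with a ha
    have h0 : Φ (0, a) = φ.symm a := by simp only [Φ, hc0, hact.one_act]
    simp only [β, MForm.onSpace_apply, h0, formMoment]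
    congr 1
    ext i
    fin_cases i
    simpa using (hdΦ a ha 1 0).symm
  have hpartial : HasFDerivAt (fun a : E => β (0, a) ![((1 : ℝ), (0 : E))])
      ((fderiv ℝ (fun z => β z ![((1 : ℝ), (0 : E))]) p).comp
        (ContinuousLinearMap.inr ℝ ℝ E)) (φ x) :=
    (hβd _).hasFDerivAt.comp (φ x) (hasFDerivAt_prodMk_right (0 : ℝ) (φ x))
  have hμ : HasFDerivAt (fun a => formMoment act τ (φ.symm a) Z)
      ((fderiv ℝ (fun z => β z ![((1 : ℝ), (0 : E))]) p).comp
        (ContinuousLinearMap.inr ℝ ℝ E)) (φ x) := hpartial.congr_of_eventuallyEq hs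
  have hμφ : (fun y => formMoment act τ y Z) =ᶠ[𝓝 x]
      fun y => formMoment act τ (φ.symm (φ y)) Z := by
    filter_upwards [extChartAt_source_mem_nhds (I := I) x] with y hy
    rw [φ.left_inv hy]
  have hφd : MDifferentiableAt I 𝓘(ℝ, E) φ x :=
    mdifferentiableAt_extChartAt (mem_chart_source A x)
  have hμd : MDifferentiableAt 𝓘(ℝ, E) 𝓘(ℝ, ℝ) (fun a => formMoment act τ (φ.symm a) Z) (φ x) :=
    hμ.differentiableAt.mdifferentiableAt
  refine ⟨(hμd.comp x hφd).congr_of_eventuallyEq hμφ, fun w => ?_⟩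
  have hdμ : modelDeriv I 𝓘(ℝ, ℝ) (fun y => formMoment act τ y Z) x w =
      fderiv ℝ (fun z => β z ![((1 : ℝ), (0 : E))]) p (0, w) := by
    rw [modelDeriv_congr hμφ, modelDeriv_comp hμd hφd rfl, modelDeriv_extChartAt,
      modelDeriv_eq_fderiv, hμ.fderiv]
    simp
  -- the value on `∂/∂a` along `a = φ x`
  have ht : fderiv ℝ (fun z => β z ![((0 : ℝ), w)]) p (1, 0) = 0 := by
    have h1 : HasFDerivAt (fun s : ℝ => β (s, φ x) ![((0 : ℝ), w)])
        ((fderiv ℝ (fun z => β z ![((0 : ℝ), w)]) p).comp (ContinuousLinearMap.inl ℝ ℝ E)) 0 :=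
      HasFDerivAt.comp (g := fun z => β z ![((0 : ℝ), w)]) (f := fun s => (s, φ x)) (0 : ℝ)
        (hβd _).hasFDerivAt (hasFDerivAt_prodMk_left (0 : ℝ) (φ x))
    have h2 : (fun s : ℝ => β (s, φ x) ![((0 : ℝ), w)]) =ᶠ[𝓝 0]
        fun _ => MForm.onSpace I τ φ.symm (φ x) ![w] := by
      have hev : ∀ᶠ s : ℝ in 𝓝 0, MDifferentiableAt 𝓘(ℝ, ℝ × E) I Φ (s, φ x) :=
        (Continuous.prodMk_left (φ x)).continuousAt.eventually
          (eventually_mdifferentiableAt (hΦ _ hφxt))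
      filter_upwards [hev] with s hsd
      have hpair : ContDiff ℝ ∞ (fun a : E => (s, a)) := contDiff_const.prodMk contDiff_id
      have h3 := MForm.pullback_comp_apply (I := 𝓘(ℝ, E)) (f := fun a : E => (s, a)) (x := φ x) τ
        hsd (hpair.contMDiff.mdifferentiableAt (by simp))
      have h4 : Φ ∘ (fun a : E => (s, a)) = act (c s) ∘ φ.symm := rfl
      rw [h4, MForm.pullback_comp_apply (I' := I) τ (hact.mdifferentiableAt_act _ _)
        (mdifferentiableAt_of_contMDiffAt (hφ _ hφxt)), hτ] at h3
      have h5 := DFunLike.congr_fun h3 ![w]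
      refine Eq.trans ?_ h5.symm
      change β (s, φ x) ![((0 : ℝ), w)] = β (s, φ x) fun i =>
        modelDeriv 𝓘(ℝ, E) 𝓘(ℝ, ℝ × E) (fun a : E => (s, a)) (φ x) (![w] i)
      rw [modelDeriv_eq_fderiv, (hasFDerivAt_prodMk_right s (φ x)).fderiv]
      congr 1
      ext i : 1
      fin_cases i
      rfl
    have h3 := (h1.congr_of_eventuallyEq h2.symm).unique
      (hasFDerivAt_const (MForm.onSpace I τ φ.symm (φ x) ![w]) (0 : ℝ))
    have h4 := DFunLike.congr_fun h3 (1 : ℝ)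
    simpa using h4
  have hd := DFunLike.congr_fun (hτs.pullback_d (hΦ _ hφxt)) ![((1 : ℝ), (0 : E)), (0, w)]
  rw [extDeriv_oneForm_apply (hβ.differentiableAt (by simp)), MForm.onSpace_apply] at hd
  have hΦp : Φ (0, φ x) = x := by simp only [Φ, hc0, hact.one_act, hφx]
  have hvec : (fun i => modelDeriv 𝓘(ℝ, ℝ × E) I Φ (0, φ x)
      (![((1 : ℝ), (0 : E)), (0, w)] i)) = ![generator F I act x Z, w] := by
    ext i : 1
    fin_cases i
    · simpa [hφx] using hdΦ _ hφxt 1 0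
    · have h := hdΦ _ hφxt 0 w
      rw [modelDeriv_extChartAt_symm] at h
      simpa using h
  rw [hΦp, hvec] at hd
  rw [hd, hdμ]
  change fderiv ℝ (fun z => β z ![((0 : ℝ), w)]) p (1, 0) - _ = _
  rw [ht, zero_sub]

/-- Variation of the pull-back of an invariant `1`-form when a plot is moved by a plot of the
group. -/
theorem onSpace_oneForm [LieGroup 𝓘(ℝ, F) ∞ K] (hact : IsSmoothAction F I act)
    {τ : MForm I M 1} (hτ : ∀ g, MForm.pullback I I (act g) τ = τ)
    {k : V → K} {q q' : V → M} {u : V} (hk : MDifferentiableAt 𝓘(ℝ, V) 𝓘(ℝ, F) k u)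
    (hq : MDifferentiableAt 𝓘(ℝ, V) I q u) (hq' : ∀ᶠ z in 𝓝 u, q' z = act (k z) (q z)) (v : V) :
    MForm.onSpace I τ q' u ![v] =
      MForm.onSpace I τ q u ![v] + formMoment act τ (q u) (leftLogDeriv F k u v) := by
  rw [hact.onSpace_act hτ hk hq hq', MForm.onSpace_apply, formMoment, add_comm]
  have h : ∀ (L : E [⋀^Fin 1]→L[ℝ] ℝ) (a b : E), L ![a + b] = L ![a] + L ![b] := by
    intro L a b
    have hu : ∀ c, Function.update ![a] 0 c = ![c] := fun c => by
      ext i : 1; fin_cases i; rfl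
    have h := L.map_update_add ![a] 0 a b
    rwa [hu, hu, hu] at h
  have h1 : (fun i => generator F I act (q u) (leftLogDeriv F k u (![v] i)) +
      modelDeriv 𝓘(ℝ, V) I q u (![v] i)) = ![generator F I act (q u) (leftLogDeriv F k u v) +
      modelDeriv 𝓘(ℝ, V) I q u v] := by
    ext i : 1; fin_cases i; rfl
  have h2 : (fun i => modelDeriv 𝓘(ℝ, V) I q u (![v] i)) = ![modelDeriv 𝓘(ℝ, V) I q u v] := by
    ext i : 1; fin_cases i; rfl
  rw [h1, h2, h, add_comm]

/-- Variation of the pull-back of an invariant `2`-form with equivariant moment map `μ` when a plot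
`q` is moved to a plot `q'` by a plot of the group: it only depends on the functions `μ ∘ q` and
`μ ∘ q'`. -/
theorem onSpace_twoForm [LieGroup 𝓘(ℝ, F) ∞ K] (hact : IsSmoothAction F I act)
    {σ : MForm I M 2} (hσ : ∀ g, MForm.pullback I I (act g) σ = σ) {μ : M → F → ℝ}
    (hμd : ∀ Z, MDifferentiable I 𝓘(ℝ, ℝ) (fun x => μ x Z))
    (hμ : ∀ (x : M) (Z : F) (w : E), σ.val x ![generator F I act x Z, w] =
      - modelDeriv I 𝓘(ℝ, ℝ) (fun y => μ y Z) x w)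
    (hμe : ∀ (k : K) (x : M) (Z : F), μ (act k x) Z = μ x (Ad F k⁻¹ Z))
    {k : V → K} {q q' : V → M} {u : V} (hk : MDifferentiableAt 𝓘(ℝ, V) 𝓘(ℝ, F) k u)
    (hq : MDifferentiableAt 𝓘(ℝ, V) I q u) (hq' : ∀ᶠ z in 𝓝 u, q' z = act (k z) (q z)) (v w : V) :
    MForm.onSpace I σ q' u ![v, w] = MForm.onSpace I σ q u ![v, w] -
      fderiv ℝ (fun z => μ (q' z) (Ad F (k u) (leftLogDeriv F k u v))) u w +
      fderiv ℝ (fun z => μ (q z) (leftLogDeriv F k u w)) u v := by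
  have hk' : MDifferentiableAt 𝓘(ℝ, V) 𝓘(ℝ, F) (fun z => (k u)⁻¹ * k z) u :=
    ((contMDiff_mul_left (I := 𝓘(ℝ, F)) (n := ∞) (a := (k u)⁻¹)).mdifferentiableAt
      (by simp)).comp u hk
  have hk1 : (k u)⁻¹ * k u = 1 := inv_mul_cancel _
  have hd : MDifferentiableAt 𝓘(ℝ, V) I (fun z => act ((k u)⁻¹ * k z) (q z)) u :=
    MDifferentiableAt.comp u (f := fun z => ((k u)⁻¹ * k z, q z))
      (g := fun x : K × M => act x.1 x.2)
      (hact.smooth.mdifferentiableAt (by simp)) (hk'.prodMk hq)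
  have hd' := hact.modelDeriv_of_eq_one hk' hq hk1 w
  set Z := leftLogDeriv F k u v with hZ
  set W := leftLogDeriv F k u w with hW
  set a := modelDeriv 𝓘(ℝ, V) I q u v with ha
  set b := modelDeriv 𝓘(ℝ, V) I q u w with hb
  have h1 : (fun i => generator F I act (q u) (leftLogDeriv F k u (![v, w] i)) +
      modelDeriv 𝓘(ℝ, V) I q u (![v, w] i)) =
      ![generator F I act (q u) Z + a, generator F I act (q u) W + b] := by
    ext i : 1; fin_cases i <;> rfl
  have h2 : (fun i => modelDeriv 𝓘(ℝ, V) I q u (![v, w] i)) = ![a, b] := by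
    ext i : 1; fin_cases i <;> rfl
  have hadd : ∀ (L : E [⋀^Fin 2]→L[ℝ] ℝ) (a₁ a₂ b₁ b₂ : E), L ![a₁ + a₂, b₁ + b₂] =
      L ![a₂, b₂] + L ![a₁, b₁ + b₂] - L ![b₁, a₂] := by
    intro L a₁ a₂ b₁ b₂
    have e1 : ∀ c, L ![a₁ + a₂, c] = L ![a₁, c] + L ![a₂, c] := fun c => by
      have h := L.map_update_add ![a₁, c] 0 a₁ a₂
      have hu : ∀ d, Function.update ![a₁, c] 0 d = ![d, c] := fun d => by
        ext i : 1; fin_cases i <;> rfl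
      rwa [hu, hu, hu] at h
    have e2 : L ![a₂, b₁ + b₂] = L ![a₂, b₁] + L ![a₂, b₂] := by
      have h := L.map_update_add ![a₂, b₁] 1 b₁ b₂
      have hu : ∀ d, Function.update ![a₂, b₁] 1 d = ![a₂, d] := fun d => by
        ext i : 1; fin_cases i <;> rfl
      rwa [hu, hu, hu] at h
    have e3 : L ![a₂, b₁] = - L ![b₁, a₂] := by
      have h := L.toAlternatingMap.map_swap ![b₁, a₂] (i := 0) (j := 1) (by decide)
      have h' : (![b₁, a₂] ∘ Equiv.swap (0 : Fin 2) 1) = ![a₂, b₁] := by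
        ext i : 1; fin_cases i <;> rfl
      rw [h'] at h
      exact h
    rw [e1, e2, e3]
    ring
  have hfirst : modelDeriv I 𝓘(ℝ, ℝ) (fun y => μ y Z) (q u) (generator F I act (q u) W + b) =
      fderiv ℝ (fun z => μ (q' z) (Ad F (k u) Z)) u w := by
    have e1 : (fun z => μ (q' z) (Ad F (k u) Z)) =ᶠ[𝓝 u]
        fun z => μ (act ((k u)⁻¹ * k z) (q z)) Z := by
      filter_upwards [hq'] with z hz
      rw [hact.mul_act, ← hz, hμe, inv_inv]
    rw [e1.fderiv_eq, ← modelDeriv_eq_fderiv, modelDeriv_comp (g := fun y => μ y Z)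
      (hμd Z (q u)) hd (by rw [hk1, hact.one_act]), ContinuousLinearMap.comp_apply, hd']
    rfl
  have hsecond : modelDeriv I 𝓘(ℝ, ℝ) (fun y => μ y W) (q u) a =
      fderiv ℝ (fun z => μ (q z) W) u v := by
    rw [← modelDeriv_eq_fderiv, modelDeriv_comp (g := fun y => μ y W) (hμd W (q u)) hq rfl]
    rfl
  rw [hact.onSpace_act hσ hk hq hq', MForm.onSpace_apply, h1, h2, hadd, hμ, hμ, hfirst, hsecond]
  ring

end IsSmoothAction

end Actions

/-! ### The cotangent bundle of a Lie group -/

section Cotangent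

variable {E : Type*} [NormedAddCommGroup E] [NormedSpace ℝ E]
  {G : Type*} [TopologicalSpace G] [ChartedSpace E G]

theorem Cotangent.ext_covector {p p' : Cotangent E G} (h1 : p.proj = p'.proj)
    (h2 : p.covector = p'.covector) : p = p' := by
  obtain ⟨x, a⟩ := p
  obtain ⟨y, b⟩ := p'
  obtain rfl : x = y := h1
  congr 1

variable [Group G]

theorem rightTranslate_covector (p : Cotangent E G) (h : G) :
    (rightTranslate p h).covector = p.covector.comp
      (modelDeriv 𝓘(ℝ, E) 𝓘(ℝ, E) (fun x : G => x * h⁻¹) (p.proj * h)) :=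
  rfl

theorem rightTranslate_one (p : Cotangent E G) : rightTranslate p (1 : G) = p := by
  refine Cotangent.ext_covector (mul_one _) ?_
  rw [rightTranslate_covector]
  simp

variable [LieGroup 𝓘(ℝ, E) ∞ G]

/-- The derivative of the inverse of the chart at `x₀`, at the point of the chart over `x`. -/
def chartSymmDeriv (x₀ x : G) : E →L[ℝ] E :=
  modelDeriv 𝓘(ℝ, E) 𝓘(ℝ, E) (extChartAt 𝓘(ℝ, E) x₀).symm (extChartAt 𝓘(ℝ, E) x₀ x)

/-- A covector, read in the trivializations of `TG` and of the trivial bundle at `x₀`. -/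
theorem cotangent_inCoordinates {x₀ x : G} (hx : x ∈ (chartAt E x₀).source)
    (φ : E →L[ℝ] ℝ) :
    ContinuousLinearMap.inCoordinates E (TangentSpace 𝓘(ℝ, E) : G → Type _) ℝ
      (Bundle.Trivial G ℝ) x₀ x x₀ x (id φ : TangentSpace 𝓘(ℝ, E) x →L[ℝ] Bundle.Trivial G ℝ x) =
        φ.comp (chartSymmDeriv x₀ x) := by
  have h := TangentBundle.symmL_trivializationAt (I := 𝓘(ℝ, E)) hx
  rw [ModelWithCorners.range_eq_univ, mfderivWithin_univ] at h
  rw [ContinuousLinearMap.inCoordinates, h]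
  ext v
  simp
  rfl

/-- The fibre coordinate of a covector in the chart of `T^*G` at `x₀`. -/
theorem cotangent_trivialization_snd {x₀ : G} {p : Cotangent E G}
    (hp : p.proj ∈ (chartAt E x₀).source) :
    (trivializationAt (E →L[ℝ] ℝ)
      (fun g : G => TangentSpace 𝓘(ℝ, E) g →L[ℝ] Bundle.Trivial G ℝ g) x₀ p).2 =
      p.covector.comp (chartSymmDeriv x₀ p.proj) := by
  rw [hom_trivializationAt_apply]
  exact cotangent_inCoordinates hp _

/-- The inverse of the chart of `T^*G` at `x₀`: the point with coordinates `(a, b)` lies over the point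
of `G` with coordinate `a`, and its covector is `b` read in the chart of `G`. -/
theorem cotangent_extChartAt_symm {x₀ : Cotangent E G} {z : E × (E →L[ℝ] ℝ)}
    (hz : z ∈ (extChartAt (cotangentModel E) x₀).target) :
    z.1 ∈ (extChartAt 𝓘(ℝ, E) x₀.proj).target ∧
    ((extChartAt (cotangentModel E) x₀).symm z).proj = (extChartAt 𝓘(ℝ, E) x₀.proj).symm z.1 ∧
    ((extChartAt (cotangentModel E) x₀).symm z).covector.comp
      (modelDeriv 𝓘(ℝ, E) 𝓘(ℝ, E) (extChartAt 𝓘(ℝ, E) x₀.proj).symm z.1) = z.2 := by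
  have h1 := hz
  rw [FiberBundle.extChartAt_target] at h1
  have h2 := (extChartAt (cotangentModel E) x₀).right_inv hz
  have h3 : ((extChartAt (cotangentModel E) x₀).symm z).proj =
      (extChartAt 𝓘(ℝ, E) x₀.proj).symm z.1 := by
    refine FiberBundle.chartedSpace_chartAt_symm_fst x₀ z ?_
    have h := hz
    simp only [extChartAt, OpenPartialHomeomorph.extend, PartialEquiv.trans_target,
      ModelWithCorners.target_eq] at h
    exact h.2
  have hs : (extChartAt 𝓘(ℝ, E) x₀.proj).symm z.1 ∈ (chartAt E x₀.proj).source := by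
    rw [← extChartAt_source (I := 𝓘(ℝ, E))]
    exact (extChartAt 𝓘(ℝ, E) x₀.proj).map_target h1.1.1
  refine ⟨h1.1.1, h3, ?_⟩
  have h4 := cotangent_trivialization_snd (x₀ := x₀.proj)
    (p := (extChartAt (cotangentModel E) x₀).symm z) (by rw [h3]; exact hs)
  rw [h3, chartSymmDeriv, (extChartAt 𝓘(ℝ, E) x₀.proj).right_inv h1.1.1] at h4
  rw [← h4]
  rw [FiberBundle.extChartAt] at h2
  conv_rhs => rw [← h2]
  rw [FiberBundle.extChartAt]
  rfl

theorem contMDiff_cotangent_proj :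
    ContMDiff (cotangentModel E) 𝓘(ℝ, E) ∞ (fun p : Cotangent E G => p.proj) :=
  contMDiff_proj _

/-- In the coordinates `(a, b)` of `T^*G` given by a chart of `G`, the canonical form is `b da`. -/
theorem isSmooth_canonicalForm :
    MForm.IsSmooth (cotangentModel E) (canonicalForm (E := E) (G := G)) := by
  intro x₀
  have hmain : ∀ z ∈ (extChartAt (cotangentModel E) x₀).target,
      MForm.inChart (cotangentModel E) (canonicalForm (E := E) (G := G)) x₀ z =
        ContinuousAlternatingMap.ofSubsingleton ℝ (E × (E →L[ℝ] ℝ)) ℝ (0 : Fin 1)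
          (z.2.comp (ContinuousLinearMap.fst ℝ E (E →L[ℝ] ℝ))) := by
    intro z hz
    obtain ⟨h1, h2, h3⟩ := cotangent_extChartAt_symm hz
    ext v
    have h4 : (fun w => ((extChartAt (cotangentModel E) x₀).symm w).proj) =ᶠ[𝓝 z]
        fun w => (extChartAt 𝓘(ℝ, E) x₀.proj).symm w.1 := by
      filter_upwards [(isOpen_extChartAt_target x₀).mem_nhds hz] with w hw
      exact (cotangent_extChartAt_symm hw).2.1
    have h5 := modelDeriv_comp (I := 𝓘(ℝ, E × (E →L[ℝ] ℝ))) (I' := cotangentModel E)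
      (I'' := 𝓘(ℝ, E)) (g := fun p' : Cotangent E G => p'.proj)
      (f := (extChartAt (cotangentModel E) x₀).symm) (x := z)
      (contMDiff_cotangent_proj.mdifferentiableAt (by simp))
      (mdifferentiableAt_of_contMDiffAt
        (contMDiffAt_extChartAt_symm_of_boundaryless hz)) rfl
    have h6 := modelDeriv_comp (I := 𝓘(ℝ, E × (E →L[ℝ] ℝ))) (I' := 𝓘(ℝ, E))
      (I'' := 𝓘(ℝ, E)) (g := (extChartAt 𝓘(ℝ, E) x₀.proj).symm)
      (f := (Prod.fst : E × (E →L[ℝ] ℝ) → E)) (x := z)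
      (mdifferentiableAt_of_contMDiffAt
        (contMDiffAt_extChartAt_symm_of_boundaryless h1))
      (contDiff_fst (n := ∞).contMDiff.mdifferentiableAt (by simp)) rfl
    rw [modelDeriv_congr h4, h6, modelDeriv_eq_fderiv, fderiv_fst] at h5
    change ((extChartAt (cotangentModel E) x₀).symm z).covector
      (modelDeriv (cotangentModel E) 𝓘(ℝ, E) (fun p' : Cotangent E G => p'.proj) _
        (modelDeriv 𝓘(ℝ, E × (E →L[ℝ] ℝ)) (cotangentModel E)
          (extChartAt (cotangentModel E) x₀).symm z (v 0))) = z.2 (v 0).1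
    rw [← h3, ← ContinuousLinearMap.comp_apply (modelDeriv (cotangentModel E) _ _ _), ← h5]
    rfl
  refine ContDiffOn.congr ?_ hmain
  have hc : ContDiff ℝ ∞ (fun z : E × (E →L[ℝ] ℝ) =>
      z.2.comp (ContinuousLinearMap.fst ℝ E (E →L[ℝ] ℝ))) :=
    contDiff_snd.clm_comp contDiff_const
  exact (contDiff_ofSubsingleton.comp hc).contDiffOn

/-- The fibre coordinate of the bundle chart of `T^*G` at `x₀` is smooth there. -/
theorem contMDiffAt_cotangent_fibre (x₀ : Cotangent E G) :
    ContMDiffAt (cotangentModel E) 𝓘(ℝ, E →L[ℝ] ℝ) ∞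
      (fun p : Cotangent E G => p.covector.comp (chartSymmDeriv x₀.proj p.proj)) x₀ := by
  have h := (contMDiffAt_totalSpace (f := fun p : Cotangent E G => p) (x₀ := x₀)
    (n := ∞) (IM := cotangentModel E) (IB := 𝓘(ℝ, E))).1 contMDiffAt_id
  refine h.2.congr_of_eventuallyEq ?_
  filter_upwards [contMDiff_cotangent_proj.continuous.continuousAt.eventually
    (chart_source_mem_nhds E x₀.proj)] with p hp
  exact (cotangent_trivialization_snd hp).symm

theorem chartSymmDeriv_comp_modelDeriv {x₀ x : G} (hx : x ∈ (chartAt E x₀).source) :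
    (chartSymmDeriv x₀ x).comp (modelDeriv 𝓘(ℝ, E) 𝓘(ℝ, E) (extChartAt 𝓘(ℝ, E) x₀) x) =
      ContinuousLinearMap.id ℝ E := by
  have h := mfderivWithin_extChartAt_symm_comp_mfderiv_extChartAt' (I := 𝓘(ℝ, E)) (x := x₀)
    (y := x) (by rwa [extChartAt_source])
  rw [ModelWithCorners.range_eq_univ, mfderivWithin_univ] at h
  exact h

/-- Right translation is smooth on `G × T^*G`: in bundle charts, the fibre coordinate of `p h` is that
of `p` composed with the coordinate expression of the derivative of `y ↦ y h⁻¹`. -/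
theorem contMDiff_rightTranslate :
    ContMDiff (𝓘(ℝ, E).prod (cotangentModel E)) (cotangentModel E) ∞
      (fun x : G × Cotangent E G => rightTranslate x.2 x.1) := by
  intro x₀
  have hproj : ContMDiff (𝓘(ℝ, E).prod (cotangentModel E)) 𝓘(ℝ, E) ∞
      (fun x : G × Cotangent E G => x.2.proj) := contMDiff_cotangent_proj.comp contMDiff_snd
  have hbase : ContMDiff (𝓘(ℝ, E).prod (cotangentModel E)) 𝓘(ℝ, E) ∞
      (fun x : G × Cotangent E G => x.2.proj * x.1) := hproj.mul contMDiff_fst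
  refine contMDiffAt_totalSpace.2 ⟨hbase x₀, ?_⟩
  have h1 : ContMDiffAt (𝓘(ℝ, E).prod (cotangentModel E)) 𝓘(ℝ, E →L[ℝ] ℝ) ∞
      (fun x : G × Cotangent E G => x.2.covector.comp (chartSymmDeriv x₀.2.proj x.2.proj)) x₀ :=
    ContMDiffAt.comp x₀ (f := Prod.snd) (contMDiffAt_cotangent_fibre x₀.2) contMDiffAt_snd
  have h2 := ContMDiffAt.mfderiv (I := 𝓘(ℝ, E)) (I' := 𝓘(ℝ, E)) (m := ∞) (n := ∞) (x₀ := x₀)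
    (J := 𝓘(ℝ, E).prod (cotangentModel E))
    (fun (x : G × Cotangent E G) (y : G) => y * x.1⁻¹) (fun x => x.2.proj * x.1)
    ((contMDiff_snd.mul (contMDiff_fst.comp contMDiff_fst).inv) _) (hbase x₀) le_rfl
  refine (h1.clm_comp h2).congr_of_eventuallyEq ?_
  filter_upwards [hproj.continuous.continuousAt.eventually (chart_source_mem_nhds E x₀.2.proj),
    hbase.continuous.continuousAt.eventually (chart_source_mem_nhds E (x₀.2.proj * x₀.1))]
    with x hx hx'
  have e1 := cotangent_trivialization_snd (p := rightTranslate x.2 x.1) (x₀ := x₀.2.proj * x₀.1) hx'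
  refine e1.trans ?_
  have e2 := inTangentCoordinates_eq_mfderiv_comp (I := 𝓘(ℝ, E)) (I' := 𝓘(ℝ, E)) (x₀ := x₀)
    (x := x) (f := fun x : G × Cotangent E G => x.2.proj * x.1)
    (g := fun x : G × Cotangent E G => x.2.proj * x.1 * x.1⁻¹)
    (ϕ := fun x => mfderiv 𝓘(ℝ, E) 𝓘(ℝ, E) (fun y : G => y * x.1⁻¹) (x.2.proj * x.1))
    hx' (by rw [mul_inv_cancel_right, mul_inv_cancel_right]; exact hx)
  rw [e2, ModelWithCorners.range_eq_univ, mfderivWithin_univ, rightTranslate_covector]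
  -- the base point `x.2.proj` occurs as `x.2.proj * x.1 * x.1⁻¹` in types of tangent vectors, so
  -- it is generalized to a variable before it is replaced
  have e3 : ∀ a b : G, a = x₀.2.proj → b = x.2.proj →
      (x.2.covector.comp (modelDeriv 𝓘(ℝ, E) 𝓘(ℝ, E) (fun y : G => y * x.1⁻¹)
        (x.2.proj * x.1))).comp (chartSymmDeriv (x₀.2.proj * x₀.1) (x.2.proj * x.1)) =
      (x.2.covector.comp (chartSymmDeriv x₀.2.proj x.2.proj)).comp
        ((modelDeriv 𝓘(ℝ, E) 𝓘(ℝ, E) (extChartAt 𝓘(ℝ, E) a) b).comp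
          ((modelDeriv 𝓘(ℝ, E) 𝓘(ℝ, E) (fun y : G => y * x.1⁻¹) (x.2.proj * x.1)).comp
            (chartSymmDeriv (x₀.2.proj * x₀.1) (x.2.proj * x.1)))) := by
    rintro _ _ rfl rfl
    have e4 := chartSymmDeriv_comp_modelDeriv hx
    ext v
    have e5 := DFunLike.congr_fun e4 (modelDeriv 𝓘(ℝ, E) 𝓘(ℝ, E) (fun y : G => y * x.1⁻¹)
      (x.2.proj * x.1) (chartSymmDeriv (x₀.2.proj * x₀.1) (x.2.proj * x.1) v))
    simp only [ContinuousLinearMap.comp_apply, ContinuousLinearMap.id_apply] at e5 ⊢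
    rw [e5]
  exact e3 _ _ (mul_inv_cancel_right _ _) (mul_inv_cancel_right _ _)

theorem mdifferentiableAt_mul_right (h x : G) :
    MDifferentiableAt 𝓘(ℝ, E) 𝓘(ℝ, E) (fun y : G => y * h) x :=
  (contMDiff_mul_right (I := 𝓘(ℝ, E)) (n := ∞) (a := h)).mdifferentiableAt (by simp)

theorem rightTranslate_mul (p : Cotangent E G) (h h' : G) :
    rightTranslate p (h * h') = rightTranslate (rightTranslate p h) h' := by
  refine Cotangent.ext_covector (mul_assoc _ _ _).symm ?_
  simp only [rightTranslate_covector]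
  have h1 : (fun x : G => x * (h * h')⁻¹) = fun x => x * h'⁻¹ * h⁻¹ := by
    funext x
    group
  have h2 : p.proj * (h * h') = p.proj * h * h' := (mul_assoc _ _ _).symm
  rw [h1, h2, modelDeriv_comp (I' := 𝓘(ℝ, E)) (g := fun x : G => x * h⁻¹)
    (mdifferentiableAt_mul_right (E := E) h⁻¹ _) (mdifferentiableAt_mul_right (E := E) h'⁻¹ _)
    (mul_inv_cancel_right _ _)]
  rfl

/-- The canonical form is invariant under right translations. -/
theorem pullback_rightTranslate_canonicalForm (h : G) :
    MForm.pullback (cotangentModel E) (cotangentModel E) (fun p : Cotangent E G =>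
      rightTranslate p h) canonicalForm = canonicalForm := by
  funext p
  have hR : ContMDiff (cotangentModel E) (cotangentModel E) ∞
      (fun p : Cotangent E G => rightTranslate p h) :=
    contMDiff_rightTranslate.comp (contMDiff_const.prodMk contMDiff_id)
  have hpd : MDifferentiableAt (cotangentModel E) 𝓘(ℝ, E) (fun p : Cotangent E G => p.proj) p :=
    contMDiff_cotangent_proj.mdifferentiableAt (by simp)
  have h1 := modelDeriv_comp (I := cotangentModel E) (I' := cotangentModel E) (I'' := 𝓘(ℝ, E))
    (g := fun p' : Cotangent E G => p'.proj) (f := fun p : Cotangent E G => rightTranslate p h)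
    (x := p) (contMDiff_cotangent_proj.mdifferentiableAt (by simp))
    (hR.mdifferentiableAt (by simp)) rfl
  have h2 := modelDeriv_comp (I := cotangentModel E) (I' := 𝓘(ℝ, E)) (I'' := 𝓘(ℝ, E))
    (g := fun x : G => x * h) (f := fun p : Cotangent E G => p.proj) (x := p)
    (mdifferentiableAt_mul_right (E := E) h p.proj) hpd rfl
  have h3 : (fun p : Cotangent E G => (rightTranslate p h).proj) = fun p => p.proj * h := rfl
  rw [h3, h2] at h1
  have h4 := modelDeriv_comp (I := 𝓘(ℝ, E)) (I' := 𝓘(ℝ, E)) (I'' := 𝓘(ℝ, E))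
    (g := fun x : G => x * h⁻¹) (f := fun x : G => x * h) (x := p.proj)
    (mdifferentiableAt_mul_right (E := E) h⁻¹ _) (mdifferentiableAt_mul_right (E := E) h p.proj) rfl
  simp only [mul_inv_cancel_right, modelDeriv_id] at h4
  have key : ∀ w : E × (E →L[ℝ] ℝ), (rightTranslate p h).covector
      ((modelDeriv (cotangentModel E) 𝓘(ℝ, E) (fun p' : Cotangent E G => p'.proj)
        (rightTranslate p h)).comp (modelDeriv (cotangentModel E) (cotangentModel E)
          (fun p : Cotangent E G => rightTranslate p h) p) w) =
      p.covector (modelDeriv (cotangentModel E) 𝓘(ℝ, E) (fun p' : Cotangent E G => p'.proj) p w) := by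
    intro w
    rw [← h1, rightTranslate_covector, ContinuousLinearMap.comp_apply,
      ContinuousLinearMap.comp_apply,
      ← ContinuousLinearMap.comp_apply (modelDeriv 𝓘(ℝ, E) 𝓘(ℝ, E) _ (p.proj * h)), ← h4,
      ContinuousLinearMap.id_apply]
  ext v
  exact key (v 0)

end Cotangent

/-! ### The action of a subgroup on the cotangent bundle -/

section SubgroupAction

variable {E : Type*} [NormedAddCommGroup E] [NormedSpace ℝ E]
  {G : Type*} [Group G] [TopologicalSpace G] [ChartedSpace E G]
  {F : Type*} [NormedAddCommGroup F] [NormedSpace ℝ F]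
  {K : Type*} [Group K] [TopologicalSpace K] [ChartedSpace F K]
  {H : Subgroup G} (e : K ≃* H)

/-- The identity near a point `x` of an open subset `u` of a finite-dimensional space factors as `f ∘ T`
through some `ℝⁿ`, with `T` defined everywhere and `f` taking its values in `u`. -/
theorem exists_contDiff_retract_of_finiteDimensional [FiniteDimensional ℝ F] {u : Set F}
    (hu : IsOpen u) {x : F} (hx : x ∈ u) :
    ∃ f : EuclideanSpace ℝ (Fin (Module.finrank ℝ F)) → F,
      ContDiff ℝ ∞ f ∧ (∀ z, f z ∈ u) ∧ ∃ T : F → EuclideanSpace ℝ (Fin (Module.finrank ℝ F)),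
        ContDiff ℝ ∞ T ∧ ∀ᶠ z in 𝓝 x, f (T z) = z := by
  let T : F ≃L[ℝ] EuclideanSpace ℝ (Fin (Module.finrank ℝ F)) := toEuclidean
  obtain ⟨f, hf, hfu, hfx⟩ := exists_contDiff_retract (hu.preimage T.symm.continuous)
    (x := T x) (by simpa using hx)
  refine ⟨fun z => T.symm (f z), T.symm.contDiff.comp hf, hfu, T, T.contDiff, ?_⟩
  filter_upwards [T.continuous.continuousAt.eventually hfx] with z hz
  rw [hz, T.symm_apply_apply]

/-- The inclusion of a subgroup with its canonical Lie group structure is smooth. -/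
theorem IsCanonicalLieStructure.contMDiff [FiniteDimensional ℝ F] [IsManifold 𝓘(ℝ, F) ∞ K]
    {e : K ≃* H} (he : IsCanonicalLieStructure (E := E) (F := F) H e) :
    ContMDiff 𝓘(ℝ, F) 𝓘(ℝ, E) ∞ (fun k : K => (e k : G)) := by
  intro k
  set φ := extChartAt 𝓘(ℝ, F) k
  obtain ⟨f, hf, hft, T, hT, hfT⟩ := exists_contDiff_retract_of_finiteDimensional
    (isOpen_extChartAt_target (I := 𝓘(ℝ, F)) k) (mem_extChartAt_target (I := 𝓘(ℝ, F)) k)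
  have hp : ContMDiff 𝓘(ℝ, EuclideanSpace ℝ (Fin (Module.finrank ℝ F))) 𝓘(ℝ, F) ∞
      (fun z => φ.symm (f z)) := fun z =>
    ContMDiffAt.comp z (contMDiffAt_extChartAt_symm_of_boundaryless (hft z))
      hf.contMDiff.contMDiffAt
  have h1 := (he _ _).1 hp
  have h2 : ContMDiffAt 𝓘(ℝ, F) 𝓘(ℝ, E) ∞ (fun l : K => (e (φ.symm (f (T (φ l)))) : G)) k :=
    ContMDiffAt.comp k (f := fun l => T (φ l)) h1.contMDiffAt
      (ContMDiffAt.comp k hT.contMDiff.contMDiffAt contMDiffAt_extChartAt)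
  refine h2.congr_of_eventuallyEq ?_
  filter_upwards [(continuousAt_extChartAt (I := 𝓘(ℝ, F)) k).eventually hfT,
    extChartAt_source_mem_nhds (I := 𝓘(ℝ, F)) k] with l hl hls
  rw [hl, φ.left_inv hls]

/-- A smooth map to `G` which takes values in the subgroup near a point agrees, near that point,
with a smooth map to the subgroup. -/
theorem IsCanonicalLieStructure.exists_lift {e : K ≃* H}
    (he : IsCanonicalLieStructure (E := E) (F := F) H e) {n : ℕ}
    {g : EuclideanSpace ℝ (Fin n) → G} (hg : ContMDiff 𝓘(ℝ, EuclideanSpace ℝ (Fin n)) 𝓘(ℝ, E) ∞ g)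
    {u : EuclideanSpace ℝ (Fin n)} (hu : ∀ᶠ z in 𝓝 u, g z ∈ H) :
    ∃ k : EuclideanSpace ℝ (Fin n) → K,
      ContMDiff 𝓘(ℝ, EuclideanSpace ℝ (Fin n)) 𝓘(ℝ, F) ∞ k ∧ ∀ᶠ z in 𝓝 u, (e (k z) : G) = g z := by
  obtain ⟨U, hU, hUo, huU⟩ := eventually_nhds_iff.1 hu
  obtain ⟨f, hf, hfU, hfu⟩ := exists_contDiff_retract hUo huU
  refine ⟨fun z => e.symm ⟨g (f z), hU _ (hfU z)⟩, (he _ _).2 ?_, ?_⟩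
  · simp only [MulEquiv.apply_symm_apply]
    exact hg.comp hf.contMDiff
  · filter_upwards [hfu] with z hz
    simp [hz]

variable [LieGroup 𝓘(ℝ, E) ∞ G]

/-- The action `k(p) = p k⁻¹` of the subgroup on `T^*G`. -/
def cotangentAction (k : K) (p : Cotangent E G) : Cotangent E G :=
  rightTranslate p ((e k : G)⁻¹)

variable {e} in
theorem isSmoothAction_cotangentAction
    (hs : ContMDiff 𝓘(ℝ, F) 𝓘(ℝ, E) ∞ (fun k : K => (e k : G))) :
    IsSmoothAction F (cotangentModel E) (cotangentAction (E := E) e) where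
  smooth := contMDiff_rightTranslate.comp
    (((hs.comp contMDiff_fst).inv).prodMk contMDiff_snd)
  one_act p := by simp [cotangentAction, rightTranslate_one]
  mul_act k l p := by
    rw [cotangentAction, cotangentAction, cotangentAction, ← rightTranslate_mul]
    simp

variable {e} in
/-- The moment attached to the canonical form is the opposite of `leftMoment`: the base
point `q` moves along `q k⁻¹`, whose velocity at `k = 1` is `- q Z`. -/
theorem formMoment_canonicalForm
    (hs : ContMDiff 𝓘(ℝ, F) 𝓘(ℝ, E) ∞ (fun k : K => (e k : G))) (p : Cotangent E G) (Z : F) :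
    formMoment (cotangentAction (E := E) e) canonicalForm p Z = - leftMoment F e p Z := by
  have hact := isSmoothAction_cotangentAction hs
  have h1 : cotangentAction (E := E) e 1 p = p := hact.one_act p
  have hpd : MDifferentiableAt (cotangentModel E) 𝓘(ℝ, E) (fun p : Cotangent E G => p.proj) p :=
    contMDiff_cotangent_proj.mdifferentiableAt (by simp)
  have hq : ContMDiff 𝓘(ℝ, F) 𝓘(ℝ, E) ∞ (fun k : K => p.proj * (e k : G)⁻¹) :=
    contMDiff_const.mul hs.inv
  have h2 := modelDeriv_comp (I := 𝓘(ℝ, F)) (I' := cotangentModel E) (I'' := 𝓘(ℝ, E))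
    (g := fun p : Cotangent E G => p.proj) (f := fun k : K => cotangentAction (E := E) e k p)
    (x := 1) hpd ((hact.contMDiff_orbit p).mdifferentiableAt (by simp)) h1
  -- differentiate `(q k⁻¹) k = q`
  have h3 := modelDeriv_comp_prodMk (J := 𝓘(ℝ, F)) (I := 𝓘(ℝ, E)) (I' := 𝓘(ℝ, E))
    (I'' := 𝓘(ℝ, E)) (f := fun x : G × G => x.1 * x.2) (a := fun k : K => p.proj * (e k : G)⁻¹)
    (b := fun k : K => (e k : G)) (u := 1)
    ((contMDiff_mul 𝓘(ℝ, E) ∞).mdifferentiableAt (by simp)) (hq.mdifferentiableAt (by simp))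
    (hs.mdifferentiableAt (by simp)) Z
  simp only [inv_mul_cancel_right, modelDeriv_const, map_one, OneMemClass.coe_one, mul_one,
    inv_one, modelDeriv_id, zero_apply, ContinuousLinearMap.id_apply] at h3
  have h4 : formMoment (cotangentAction (E := E) e) canonicalForm p Z =
      p.covector (modelDeriv 𝓘(ℝ, F) 𝓘(ℝ, E) (fun k : K => p.proj * (e k : G)⁻¹) 1 Z) := by
    have h5 : modelDeriv 𝓘(ℝ, F) 𝓘(ℝ, E) (fun k : K => p.proj * (e k : G)⁻¹) 1 = _ := h2
    rw [h5]
    rfl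
  rw [h4, eq_neg_of_add_eq_zero_left h3.symm, map_neg]
  rfl

end SubgroupAction

/-! ### Forms on reduced spaces -/

section Reduction

variable {E : Type*} [NormedAddCommGroup E] [NormedSpace ℝ E] {A : Type*} [TopologicalSpace A]
  {I : ModelWithCorners ℝ E A} {M : Type*} [TopologicalSpace M] [ChartedSpace A M]

/-- A form descends to the reduced space if its pull-backs by plots of the level set are smooth and
only depend on the plots modulo the group. The value of the reduced form on a plot of the quotient
is the pull-back by any local lift. -/
theorem carriesReducedForm_of_onSpace_eq {K : Type*} [Group K] {act : K → M → M} {C : Set M}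
    {n : ℕ} {σ : MForm I M n} (hone : ∀ x, act 1 x = x)
    (hmul : ∀ k l x, act (k * l) x = act k (act l x))
    (hsmooth : ∀ {m : ℕ} (q : EuclideanSpace ℝ (Fin m) → M),
      ContMDiff 𝓘(ℝ, EuclideanSpace ℝ (Fin m)) I ∞ q → ContDiff ℝ ∞ (MForm.onSpace I σ q))
    (hlift : ∀ {m : ℕ} (q q' : EuclideanSpace ℝ (Fin m) → M) (u : EuclideanSpace ℝ (Fin m)),
      ContMDiff 𝓘(ℝ, EuclideanSpace ℝ (Fin m)) I ∞ q →
      ContMDiff 𝓘(ℝ, EuclideanSpace ℝ (Fin m)) I ∞ q' → (∀ z, q z ∈ C) → (∀ z, q' z ∈ C) →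
      (∀ᶠ z in 𝓝 u, ∃ k, q' z = act k (q z)) →
      MForm.onSpace I σ q' u = MForm.onSpace I σ q u) :
    CarriesReducedForm I act C σ := by
  have heqv : Equivalence fun x y : C => ∃ k : K, (y : M) = act k x := by
    refine ⟨fun x => ⟨1, (hone _).symm⟩, ?_, ?_⟩
    · rintro x y ⟨k, hk⟩
      exact ⟨k⁻¹, by rw [hk, ← hmul, inv_mul_cancel, hone]⟩
    · rintro x y z ⟨k, hk⟩ ⟨l, hl⟩
      exact ⟨l * k, by rw [hl, hk, hmul]⟩
  have hlift' : ∀ {m : ℕ} (q q' : EuclideanSpace ℝ (Fin m) → C) (u : EuclideanSpace ℝ (Fin m)),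
      q ∈ (subsetDiffeology (manifoldDiffeology I M) C).plots m →
      q' ∈ (subsetDiffeology (manifoldDiffeology I M) C).plots m →
      (∀ᶠ z in 𝓝 u, Quot.mk (fun x y : C => ∃ k : K, (y : M) = act k x) (q z) =
        Quot.mk (fun x y : C => ∃ k : K, (y : M) = act k x) (q' z)) →
      MForm.onSpace I σ (fun z => (q' z : M)) u = MForm.onSpace I σ (fun z => (q z : M)) u := by
    intro m q q' u hq hq' h
    refine hlift _ _ u hq hq' (fun z => (q z).2) (fun z => (q' z).2) ?_
    filter_upwards [h] with z hz
    exact heqv.quot_mk_eq_iff _ _ |>.1 hz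
  let form : ∀ {m : ℕ} (p : EuclideanSpace ℝ (Fin m) → ReducedSpace act C),
      p ∈ (reducedDiffeology I act C).plots m →
      EuclideanSpace ℝ (Fin m) → EuclideanSpace ℝ (Fin m) [⋀^Fin n]→L[ℝ] ℝ :=
    fun p hp u => MForm.onSpace I σ (fun z => ((hp u).choose z : M)) u
  have hform : ∀ {m : ℕ} (p : EuclideanSpace ℝ (Fin m) → ReducedSpace act C)
      (hp : p ∈ (reducedDiffeology I act C).plots m) (q : EuclideanSpace ℝ (Fin m) → C)
      (_ : q ∈ (subsetDiffeology (manifoldDiffeology I M) C).plots m)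
      (u : EuclideanSpace ℝ (Fin m)), (∀ᶠ z in 𝓝 u, p z = Quot.mk _ (q z)) →
      form p hp u = MForm.onSpace I σ (fun z => (q z : M)) u := by
    intro m p hp q hq u hpq
    refine hlift' _ _ u hq (hp u).choose_spec.1 ?_
    filter_upwards [hpq, (hp u).choose_spec.2] with z h1 h2
    exact h1.symm.trans h2
  refine ⟨⟨form, ?_, ?_⟩, ?_⟩
  · intro m p hp
    refine contDiff_iff_contDiffAt.2 fun u => ?_
    obtain ⟨q, hq, hpq⟩ := hp u
    refine (hsmooth (fun z => (q z : M)) hq).contDiffAt.congr_of_eventuallyEq ?_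
    filter_upwards [hpq.eventually_nhds] with z hz using hform p hp q hq z hz
  · intro n' m p hp f hf u
    obtain ⟨q, hq, hpq⟩ := hp (f u)
    have hq' : ContMDiff 𝓘(ℝ, EuclideanSpace ℝ (Fin m)) I ∞ (fun z => (q z : M)) := hq
    rw [hform p hp q hq (f u) hpq, hform (p ∘ f) _ (q ∘ f)
      ((subsetDiffeology (manifoldDiffeology I M) C).plot_reparam hq hf) u
      (hf.continuous.continuousAt.eventually hpq)]
    have h := MForm.pullback_comp_apply (I := 𝓘(ℝ, EuclideanSpace ℝ (Fin n')))
      (I' := 𝓘(ℝ, EuclideanSpace ℝ (Fin m))) (f := f) (g := fun z => (q z : M)) (x := u) σ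
      (hq'.mdifferentiableAt (by simp)) (hf.contMDiff.mdifferentiableAt (by simp))
    rw [mfderiv_eq_fderiv] at h
    exact h
  · intro m p hp u
    exact hform _ _ p hp u (Filter.Eventually.of_forall fun _ => rfl)

end Reduction

/-! ### The induced space -/

section Algebra

variable {E : Type*} [NormedAddCommGroup E] [NormedSpace ℝ E]
  {G : Type*} [Group G] [TopologicalSpace G] [ChartedSpace E G]
  {H : Subgroup G} {K : Type*} [Group K] {e : K ≃* H} {Y : Type*}

theorem inducingAction_one [MulAction K Y] (x : Cotangent E G × Y) :
    inducingAction E e 1 x = x := by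
  simp [inducingAction, rightTranslate_one]

theorem inducingAction_mul [LieGroup 𝓘(ℝ, E) ∞ G] [MulAction K Y] (k l : K) (x : Cotangent E G × Y) :
    inducingAction E e (k * l) x = inducingAction E e k (inducingAction E e l x) := by
  simp [inducingAction, ← rightTranslate_mul, mul_smul]

theorem leftMoment_eq_of_mem_zeroLevel {F : Type*} [NormedAddCommGroup F] [NormedSpace ℝ F] [TopologicalSpace K]
    [ChartedSpace F K] {Ψ : Y → (F →L[ℝ] ℝ)} {x : Cotangent E G × Y}
    (hx : x ∈ zeroLevel e Ψ) (Z : F) : leftMoment F e x.1 Z = Ψ x.2 Z := by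
  have h : Ψ x.2 - leftMoment F e x.1 = 0 := hx
  rw [sub_eq_zero.1 h]

end Algebra

section Induced

variable {E : Type*} [NormedAddCommGroup E] [NormedSpace ℝ E]
  {G : Type*} [Group G] [TopologicalSpace G] [ChartedSpace E G] [LieGroup 𝓘(ℝ, E) ∞ G]
  {H : Subgroup G}
  {F : Type*} [NormedAddCommGroup F] [NormedSpace ℝ F]
  {K : Type*} [Group K] [TopologicalSpace K] [ChartedSpace F K]
  {e : K ≃* H}
  {E' : Type*} [NormedAddCommGroup E'] [NormedSpace ℝ E']
  {Y : Type*} [TopologicalSpace Y] [ChartedSpace E' Y]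

theorem onSpace_sumForm {n : ℕ} (α : MForm (cotangentModel E) (Cotangent E G) n)
    (β : MForm 𝓘(ℝ, E') Y n) {m : ℕ} {q : EuclideanSpace ℝ (Fin m) → Cotangent E G × Y}
    {u : EuclideanSpace ℝ (Fin m)}
    (hq : MDifferentiableAt 𝓘(ℝ, EuclideanSpace ℝ (Fin m)) (inducingModel E E') q u) :
    MForm.onSpace (inducingModel E E') (sumForm α β) q u =
      MForm.onSpace (cotangentModel E) α (fun z => (q z).1) u +
        MForm.onSpace 𝓘(ℝ, E') β (fun z => (q z).2) u := by
  have h1 := MForm.pullback_comp_apply (I := 𝓘(ℝ, EuclideanSpace ℝ (Fin m))) α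
    (mdifferentiableAt_fst (I := cotangentModel E) (I' := 𝓘(ℝ, E')) (x := q u)) hq
  have h2 := MForm.pullback_comp_apply (I := 𝓘(ℝ, EuclideanSpace ℝ (Fin m))) β
    (mdifferentiableAt_snd (I := cotangentModel E) (I' := 𝓘(ℝ, E')) (x := q u)) hq
  have h3 : MForm.onSpace (inducingModel E E') (sumForm α β) q u = _ + _ :=
    congrArg₂ (· + ·) h1.symm h2.symm
  exact h3

theorem isSmoothAction_smul [MulAction K Y] [ContMDiffSMul 𝓘(ℝ, F) 𝓘(ℝ, E') ∞ K Y] :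
    IsSmoothAction F 𝓘(ℝ, E') (fun (k : K) (y : Y) => k • y) where
  smooth := ContMDiffSMul.contMDiff_smul
  one_act := one_smul K
  mul_act := mul_smul

/-- Two plots of `T^*G × Y` with the same orbits differ by a plot of the subgroup: the group element
is determined by the base points in `G`, on which the subgroup acts freely, so that its
smoothness is that of a map into `G`. -/
theorem IsCanonicalLieStructure.exists_plot [MulAction K Y]
    (he : IsCanonicalLieStructure (E := E) (F := F) H e) {m : ℕ}
    {q q' : EuclideanSpace ℝ (Fin m) → Cotangent E G × Y} {u : EuclideanSpace ℝ (Fin m)}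
    (hq : ContMDiff 𝓘(ℝ, EuclideanSpace ℝ (Fin m)) (inducingModel E E') ∞ q)
    (hq' : ContMDiff 𝓘(ℝ, EuclideanSpace ℝ (Fin m)) (inducingModel E E') ∞ q')
    (h : ∀ᶠ z in 𝓝 u, ∃ k, q' z = inducingAction E e k (q z)) :
    ∃ k : EuclideanSpace ℝ (Fin m) → K,
      ContMDiff 𝓘(ℝ, EuclideanSpace ℝ (Fin m)) 𝓘(ℝ, F) ∞ k ∧
      ∀ᶠ z in 𝓝 u, q' z = inducingAction E e (k z) (q z) := by
  have hbase : ∀ {r : EuclideanSpace ℝ (Fin m) → Cotangent E G × Y},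
      ContMDiff 𝓘(ℝ, EuclideanSpace ℝ (Fin m)) (inducingModel E E') ∞ r →
      ContMDiff 𝓘(ℝ, EuclideanSpace ℝ (Fin m)) 𝓘(ℝ, E) ∞ (fun z => (r z).1.proj) := fun hr =>
    contMDiff_cotangent_proj.comp (contMDiff_fst.comp hr)
  have key : ∀ z k, q' z = inducingAction E e k (q z) →
      (e k : G) = ((q' z).1.proj)⁻¹ * (q z).1.proj := by
    intro z k hk
    have h1 : (q' z).1.proj = (q z).1.proj * (e k : G)⁻¹ := by rw [hk]; rfl
    rw [h1]
    group
  obtain ⟨κ, hκ, hκe⟩ := he.exists_lift ((hbase hq').inv.mul (hbase hq)) (u := u) (by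
    filter_upwards [h] with z hz
    obtain ⟨k, hk⟩ := hz
    have h2 := key z k hk
    change ((q' z).1.proj)⁻¹ * (q z).1.proj ∈ H
    rw [← h2]
    exact (e k).2)
  refine ⟨κ, hκ, ?_⟩
  filter_upwards [h, hκe] with z hz hz'
  obtain ⟨k, hk⟩ := hz
  have h3 : κ z = k := e.injective (Subtype.ext (hz'.trans (key z k hk).symm))
  rw [h3, hk]

variable [FiniteDimensional ℝ F] [LieGroup 𝓘(ℝ, F) ∞ K] [IsManifold 𝓘(ℝ, E') ∞ Y]
  [MulAction K Y] [ContMDiffSMul 𝓘(ℝ, F) 𝓘(ℝ, E') ∞ K Y]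

/-- The reduced `2`-form of a Hamiltonian space. -/
theorem carriesReducedForm_inducingTwoForm
    (he : IsCanonicalLieStructure (E := E) (F := F) H e)
    {σ : MForm 𝓘(ℝ, E') Y 2} {Ψ : Y → (F →L[ℝ] ℝ)} (hY : IsHamiltonianSpace K σ Ψ) :
    CarriesReducedForm (inducingModel E E') (inducingAction E e) (zeroLevel (E := E) e Ψ)
      (inducingTwoForm σ) := by
  have hsG := he.contMDiff
  have hactG := isSmoothAction_cotangentAction (E := E) hsG
  have hactY := isSmoothAction_smul (F := F) (K := K) (E' := E') (Y := Y)
  have hinvG : ∀ k, MForm.pullback (cotangentModel E) (cotangentModel E)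
      (cotangentAction (E := E) e k) canonicalForm = canonicalForm := fun k =>
    pullback_rightTranslate_canonicalForm _
  have hdG := fun x Z => hactG.d_generator isSmooth_canonicalForm hinvG x Z
  have hΨd : ∀ Z, MDifferentiable 𝓘(ℝ, E') 𝓘(ℝ, ℝ) (fun y => Ψ y Z) := fun Z y =>
    ((ContinuousLinearMap.apply ℝ ℝ Z).contMDiff.comp
      hY.smooth_moment).mdifferentiableAt (n := ∞) (by simp)
  refine carriesReducedForm_of_onSpace_eq inducingAction_one inducingAction_mul ?_ ?_
  · intro m q hq
    refine contDiff_iff_contDiffAt.2 fun u => ?_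
    have h1 : MForm.onSpace (inducingModel E E') (inducingTwoForm σ) q = fun u =>
        MForm.onSpace (cotangentModel E) (MForm.d (cotangentModel E) canonicalForm)
          (fun z => (q z).1) u + MForm.onSpace 𝓘(ℝ, E') σ (fun z => (q z).2) u :=
      funext fun u => onSpace_sumForm _ _ (hq.mdifferentiableAt (by simp))
    rw [h1]
    exact (isSmooth_canonicalForm.contDiffAt_pullback_d (contMDiff_fst.comp hq) u).add
      (hY.symplectic.smooth.contDiffAt_pullback (contMDiff_snd.comp hq u))
  · intro m q q' u hq hq' hC hC' hqq'
    obtain ⟨k, hk, hkq⟩ := he.exists_plot hq hq' hqq'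
    have hq1 : ContMDiff 𝓘(ℝ, EuclideanSpace ℝ (Fin m)) (cotangentModel E) ∞
        (fun z => (q z).1) := contMDiff_fst.comp hq
    have hq2 : ContMDiff 𝓘(ℝ, EuclideanSpace ℝ (Fin m)) 𝓘(ℝ, E') ∞ (fun z => (q z).2) :=
      contMDiff_snd.comp hq
    have hkd := hk.mdifferentiableAt (x := u) (by simp)
    rw [inducingTwoForm, onSpace_sumForm _ _ (hq.mdifferentiableAt (by simp)),
      onSpace_sumForm _ _ (hq'.mdifferentiableAt (by simp))]
    ext v
    have hv : v = ![v 0, v 1] := by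
      ext i : 1
      fin_cases i <;> rfl
    rw [hv]
    have hG := hactG.onSpace_twoForm
      (fun g => isSmooth_canonicalForm.pullback_d_self (hactG.contMDiff_act g) (hinvG g))
      (fun Z x => (hdG x Z).1) (fun x Z => (hdG x Z).2) (hactG.formMoment_act hinvG) hkd
      (hq1.mdifferentiableAt (by simp)) (hkq.mono fun z hz => congrArg Prod.fst hz) (v 0) (v 1)
    have hYv := hactY.onSpace_twoForm hY.invariant (μ := fun y Z => Ψ y Z) hΨd
      (fun y Z w => hY.moment y Z w) hY.equivariant hkd (hq2.mdifferentiableAt (by simp))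
      (hkq.mono fun z hz => congrArg Prod.snd hz) (v 0) (v 1)
    -- on the level set, the moments of `T^*G` and of `Y` are opposite
    have hopp : ∀ (r : EuclideanSpace ℝ (Fin m) → Cotangent E G × Y),
        (∀ z, r z ∈ zeroLevel e Ψ) → ∀ Z : F,
        (fun z => formMoment (cotangentAction (E := E) e) canonicalForm (r z).1 Z) =
          fun z => - Ψ (r z).2 Z := fun r hr Z => funext fun z => by
      rw [formMoment_canonicalForm hsG, leftMoment_eq_of_mem_zeroLevel (hr z)]
    rw [hopp q hC, hopp q' hC', fderiv_fun_neg, fderiv_fun_neg] at hG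
    simp only [ContinuousAlternatingMap.add_apply, hG, hYv, neg_apply]
    ring

/-- The reduced `1`-form of a prequantum space. -/
theorem carriesReducedForm_inducingOneForm
    (he : IsCanonicalLieStructure (E := E) (F := F) H e)
    {ϖ : MForm 𝓘(ℝ, E') Y 1} (hY : IsPrequantumSpace K ϖ) :
    CarriesReducedForm (inducingModel E E') (inducingAction E e)
      (zeroLevel (E := E) e (prequantumMoment (F := F) (K := K) ϖ)) (inducingOneForm ϖ) := by
  have hsG := he.contMDiff
  have hactG := isSmoothAction_cotangentAction (E := E) hsG
  have hactY := isSmoothAction_smul (F := F) (K := K) (E' := E') (Y := Y)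
  have hinvG : ∀ k, MForm.pullback (cotangentModel E) (cotangentModel E)
      (cotangentAction (E := E) e k) canonicalForm = canonicalForm := fun k =>
    pullback_rightTranslate_canonicalForm _
  refine carriesReducedForm_of_onSpace_eq inducingAction_one inducingAction_mul ?_ ?_
  · intro m q hq
    refine contDiff_iff_contDiffAt.2 fun u => ?_
    have h1 : MForm.onSpace (inducingModel E E') (inducingOneForm ϖ) q = fun u =>
        MForm.onSpace (cotangentModel E) canonicalForm (fun z => (q z).1) u +
          MForm.onSpace 𝓘(ℝ, E') ϖ (fun z => (q z).2) u :=
      funext fun u => onSpace_sumForm _ _ (hq.mdifferentiableAt (by simp))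
    rw [h1]
    exact (isSmooth_canonicalForm.contDiffAt_pullback (contMDiff_fst.comp hq u)).add
      (hY.contact.smooth.contDiffAt_pullback (contMDiff_snd.comp hq u))
  · intro m q q' u hq hq' hC hC' hqq'
    obtain ⟨k, hk, hkq⟩ := he.exists_plot hq hq' hqq'
    have hq1 : ContMDiff 𝓘(ℝ, EuclideanSpace ℝ (Fin m)) (cotangentModel E) ∞
        (fun z => (q z).1) := contMDiff_fst.comp hq
    have hq2 : ContMDiff 𝓘(ℝ, EuclideanSpace ℝ (Fin m)) 𝓘(ℝ, E') ∞ (fun z => (q z).2) :=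
      contMDiff_snd.comp hq
    have hkd := hk.mdifferentiableAt (x := u) (by simp)
    rw [inducingOneForm, onSpace_sumForm _ _ (hq.mdifferentiableAt (by simp)),
      onSpace_sumForm _ _ (hq'.mdifferentiableAt (by simp))]
    ext v
    have hv : v = ![v 0] := by
      ext i : 1
      fin_cases i
      rfl
    rw [hv]
    have hG := hactG.onSpace_oneForm hinvG hkd (hq1.mdifferentiableAt (by simp))
      (hkq.mono fun z hz => congrArg Prod.fst hz) (v 0)
    have hYv := hactY.onSpace_oneForm hY.invariant hkd (hq2.mdifferentiableAt (by simp))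
      (hkq.mono fun z hz => congrArg Prod.snd hz) (v 0)
    have hmom : ∀ Z : F, formMoment (fun (k : K) (y : Y) => k • y) ϖ (q u).2 Z =
        prequantumMoment (K := K) ϖ (q u).2 Z := by
      intro Z
      change (ϖ.val (q u).2) _ = (ϖ.val (q u).2) _
      congr 1
      ext i : 1
      fin_cases i
      rfl
    rw [formMoment_canonicalForm hsG, leftMoment_eq_of_mem_zeroLevel (hC u), ← hmom] at hG
    simp only [ContinuousAlternatingMap.add_apply, hG, hYv]
    ring

end Induced

end Induction

end

theorem mainTheorem8
    {E : Type*} [NormedAddCommGroup E] [NormedSpace ℝ E] [FiniteDimensional ℝ E]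
    {G : Type*} [Group G] [TopologicalSpace G] [ChartedSpace E G] [LieGroup 𝓘(ℝ, E) ∞ G]
    (H : Subgroup G)
    {F : Type*} [NormedAddCommGroup F] [NormedSpace ℝ F] [FiniteDimensional ℝ F]
    {K : Type*} [Group K] [TopologicalSpace K] [ChartedSpace F K] [LieGroup 𝓘(ℝ, F) ∞ K]
    (e : K ≃* H) (he : Induction.IsCanonicalLieStructure (E := E) (F := F) H e)
    {E' : Type*} [NormedAddCommGroup E'] [NormedSpace ℝ E'] [FiniteDimensional ℝ E']
    {Y : Type*} [TopologicalSpace Y] [ChartedSpace E' Y] [IsManifold 𝓘(ℝ, E') ∞ Y]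
    [MulAction K Y] [ContMDiffSMul 𝓘(ℝ, F) 𝓘(ℝ, E') ∞ K Y] :
    (∀ (σ : Induction.MForm 𝓘(ℝ, E') Y 2) (Ψ : Y → (F →L[ℝ] ℝ)),
      Induction.IsHamiltonianSpace K σ Ψ →
        Induction.CarriesReducedForm (Induction.inducingModel E E')
          (Induction.inducingAction E e) (Induction.zeroLevel e Ψ)
          (Induction.inducingTwoForm σ)) ∧
    (∀ ϖ : Induction.MForm 𝓘(ℝ, E') Y 1,
      Induction.IsPrequantumSpace K ϖ →
        Induction.CarriesReducedForm (Induction.inducingModel E E')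
          (Induction.inducingAction E e)
          (Induction.zeroLevel e (Induction.prequantumMoment (F := F) (K := K) ϖ))
          (Induction.inducingOneForm ϖ)) :=
  ⟨fun _ _ h => Induction.carriesReducedForm_inducingTwoForm he h,
    fun _ h => Induction.carriesReducedForm_inducingOneForm he h⟩
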